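/- An election consists of $m$ candidates and a list of $n$ voters; voter $i$ has a strict preference order over the candidates and an approval count $\ell^i\in\{0,\dots,m\}$, and approves of the top $\ell^i$ candidates of her order. Under the simplified Fallback rule, the winners are determined as follows. For $k\ge 1$, let $s_k(c)$ be the number of voters who approve of $c$ and rank $c$ among their top $k$ candidates. If $s_k(c)\ge\lfloor n/2\rfloor+1$ for some $k$ and $c$, then, for the smallest such $k$, the winners are all candidates $c$ with $s_k(c)\ge\lfloor n/2\rfloor+1$. Otherwise the winners are the candidates approved by the largest number of voters. In the shift bribery problem one is given an election, a designated candidate $p$, and for each voter $i$ a non-decreasing function $\pi^i:\{0,\dots,m\}\to\mathbb{Z}_{\ge 0}\cup\{+\infty\}$ with $\pi^i(0)=0$, specified by the list of its values (written in binary). A shift action $\mathbf t=(t_1,\dots,t_n)\in\{0,\dots,m\}^n$ moves $p$ upwards by $t_i$ positions in the preference order of each voter $i$ (to the top, if fewer than $t_i$ candidates are above $p$) and leaves the approval counts unchanged; it is successful if $p$ is a winner of the resulting election, and its cost is $\sum_{i=1}^n\pi^i(t_i)$. The goal is to find a successful shift action whose cost is minimum among all successful shift actions. **Theorem.** For the simplified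 Fallback rule, shift bribery can be solved optimally in polynomial time: there is an algorithm which, on every instance, outputs a successful shift action of minimum cost, in time polynomial in the description length of the instance. -/

import Mathlib

/-! ## Machine model

A random access machine, programmed in structured form, under the logarithmic cost criterion: the
only arithmetic is addition and truncated subtraction of natural numbers, and every operation is
charged the bit lengths of the numbers it handles (values and addresses). Running times in this
model and on multitape Turing machines are polynomially related. -/

namespace RAM

/-- A configuration of the memory: scalar registers, arrays (`arr a i` is cell `i` of array `a`),
and an append-only output tape. A program refers to finitely many registers and arrays only. -/
structure State where
  reg : ℕ → ℕ
  arr : ℕ → ℕ → ℕ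
  out : List ℕ

/-- Arithmetic expressions; `get a e` reads the cell of the array `a` whose address is the value
of `e`. -/
inductive Expr where
  | lit (k : ℕ)
  | var (x : ℕ)
  | get (a : ℕ) (e : Expr)
  | add (e₁ e₂ : Expr)
  | sub (e₁ e₂ : Expr)

/-- The value of an expression (`sub` is truncated subtraction). -/
def Expr.eval (s : State) : Expr → ℕ
  | .lit k => k
  | .var x => s.reg x
  | .get a e => s.arr a (e.eval s)
  | .add e₁ e₂ => e₁.eval s + e₂.eval s
  | .sub e₁ e₂ => e₁.eval s - e₂.eval s

/-- The logarithmic cost of evaluating an expression: every node of the expression costs one plus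
the bit length of its value. -/
def Expr.cost (s : State) : Expr → ℕ
  | .lit k => 1 + k.size
  | .var x => 1 + (s.reg x).size
  | .get a e => 1 + (s.arr a (e.eval s)).size + e.cost s
  | .add e₁ e₂ => 1 + (e₁.eval s + e₂.eval s).size + e₁.cost s + e₂.cost s
  | .sub e₁ e₂ => 1 + (e₁.eval s - e₂.eval s).size + e₁.cost s + e₂.cost s

/-- Programs: assignment to a register, assignment to an array cell (`store a e₁ e₂` puts the value
of `e₂` into cell `e₁` of `a`), writing a number on the output tape, sequencing, and branching and
looping on the condition that an expression is nonzero. -/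
inductive Cmd where
  | skip
  | assign (x : ℕ) (e : Expr)
  | store (a : ℕ) (e₁ e₂ : Expr)
  | emit (e : Expr)
  | seq (c₁ c₂ : Cmd)
  | cond (e : Expr) (c₁ c₂ : Cmd)
  | loop (e : Expr) (c : Cmd)

/-- The state after the assignment of `v` to register `x`. -/
def State.setReg (s : State) (x v : ℕ) : State :=
  { s with reg := Function.update s.reg x v }

/-- The state after the assignment of `v` to cell `i` of array `a`. -/
def State.setArr (s : State) (a i v : ℕ) : State :=
  { s with arr := Function.update s.arr a (Function.update (s.arr a) i v) }

/-- `Exec c s s' k`: started in state `s`, the program `c` halts in state `s'`, and the logarithmic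
cost of the run is `k`. -/
inductive Exec : Cmd → State → State → ℕ → Prop where
  | skip (s : State) : Exec .skip s s 1
  | assign (x : ℕ) (e : Expr) (s : State) :
      Exec (.assign x e) s (s.setReg x (e.eval s)) (1 + e.cost s)
  | store (a : ℕ) (e₁ e₂ : Expr) (s : State) :
      Exec (.store a e₁ e₂) s (s.setArr a (e₁.eval s) (e₂.eval s)) (1 + e₁.cost s + e₂.cost s)
  | emit (e : Expr) (s : State) :
      Exec (.emit e) s { s with out := s.out ++ [e.eval s] } (1 + e.cost s)
  | seq {c₁ c₂ : Cmd} {s s' s'' : State} {k₁ k₂ : ℕ} :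
      Exec c₁ s s' k₁ → Exec c₂ s' s'' k₂ → Exec (.seq c₁ c₂) s s'' (1 + k₁ + k₂)
  | cond_true {e : Expr} {c₁ c₂ : Cmd} {s s' : State} {k : ℕ} :
      e.eval s ≠ 0 → Exec c₁ s s' k → Exec (.cond e c₁ c₂) s s' (1 + e.cost s + k)
  | cond_false {e : Expr} {c₁ c₂ : Cmd} {s s' : State} {k : ℕ} :
      e.eval s = 0 → Exec c₂ s s' k → Exec (.cond e c₁ c₂) s s' (1 + e.cost s + k)
  | loop_true {e : Expr} {c : Cmd} {s s' s'' : State} {k₁ k₂ : ℕ} :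
      e.eval s ≠ 0 → Exec c s s' k₁ → Exec (.loop e c) s' s'' k₂ →
        Exec (.loop e c) s s'' (1 + e.cost s + k₁ + k₂)
  | loop_false {e : Expr} {c : Cmd} {s : State} :
      e.eval s = 0 → Exec (.loop e c) s s (1 + e.cost s)

/-- The initial state on the input word list `w`: array `0` holds `w`, register `0` holds the length
of `w`, everything else is `0`, and the output tape is empty. -/
def init (w : List ℕ) : State where
  reg := fun x => if x = 0 then w.length else 0
  arr := fun a i => if a = 0 then w.getD i 0 else 0
  out := []

/-- The length of the description of a list of natural numbers written in binary. -/
def bitLength (w : List ℕ) : ℕ :=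
  (w.map fun x => x.size + 1).sum

/-- A search problem (`Sol a b`: "`b` is a correct answer on the instance `a`"), with the given
encodings of instances and answers, is solvable in polynomial time: there is one program which on
every instance halts, after a run whose cost is at most a fixed polynomial in the description length
of the instance, with (the encoding of) a correct answer on its output tape. -/
def SolvableInPolyTime {α : Type} {β : α → Type} (encIn : α → List ℕ)
    (encOut : (a : α) → β a → List ℕ) (Sol : (a : α) → β a → Prop) : Prop :=
  ∃ (c : Cmd) (q : Polynomial ℕ), ∀ a : α, ∃ (b : β a) (s : State) (k : ℕ),
    Exec c (init (encIn a)) s k ∧ k ≤ q.eval (bitLength (encIn a)) ∧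
      s.out = encOut a b ∧ Sol a b

end RAM

/-! ## Elections -/

namespace Voting

/-- A voter over the candidates `Fin m`: a preference order, given by the positions `pos c` of the
candidates (`0` is the most preferred, so the rank of `c` is `pos c + 1`), and an approval count,
the voter approving of the candidates in her top `approvals` positions. -/
structure Voter (m : ℕ) where
  pos : Equiv.Perm (Fin m)
  approvals : Fin (m + 1)

/-- The rank of a candidate in the preference order of a voter (`1` for the most preferred). -/
def Voter.rank {m : ℕ} (v : Voter m) (c : Fin m) : ℕ :=
  (v.pos c : ℕ) + 1

/-- An election with candidates `Fin m` and a list of `n` voters. -/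
abbrev Election (m n : ℕ) : Type := Fin n → Voter m

/-- A voting rule maps every election to a set of winners. -/
abbrev VotingRule : Type := (m n : ℕ) → Election m n → Set (Fin m)

/-- The approval score of `c`: the number of voters that approve of her. -/
def approvalScore {m n : ℕ} (E : Election m n) (c : Fin m) : ℕ :=
  (Finset.univ.filter fun i : Fin n => (E i).rank c ≤ ((E i).approvals : ℕ)).card

/-- The `k`-approval score of `c` after the deletion of each voter's non-approved candidates from
her ranking: the number of voters that approve of `c` and rank her in the top `k` positions. -/
def truncScore {m n : ℕ} (E : Election m n) (k : ℕ) (c : Fin m) : ℕ :=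
  (Finset.univ.filter fun i : Fin n =>
    (E i).rank c ≤ ((E i).approvals : ℕ) ∧ (E i).rank c ≤ k).card

/-- `c` has a strict majority in round `k` in the truncated election. -/
def HasMajority {m n : ℕ} (E : Election m n) (k : ℕ) (c : Fin m) : Prop :=
  n / 2 + 1 ≤ truncScore E k c

/-- The simplified Fallback rule. If some candidate has a majority in some round, then the winners
are all candidates that have a majority in the earliest such round; if there is no such candidate,
then the winners are the candidates with the highest approval score. -/
def simplifiedFallback : VotingRule := fun _ _ E =>
  {c | (∃ k, IsLeast {j | ∃ d, HasMajority E j d} k ∧ HasMajority E k c) ∨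
       ((¬ ∃ k d, HasMajority E k d) ∧ ∀ d, approvalScore E d ≤ approvalScore E c)}

/-- The vote obtained by shifting `p` upwards by `t` positions (to the top, if there are fewer than
`t` candidates above her): `p` moves from position `b` to position `b - t`, the candidates in
positions `b - t, …, b - 1` move down by one, and all others stay where they are. The approval count
does not change. -/
def Voter.shift {m : ℕ} (v : Voter m) (p : Fin m) (t : ℕ) : Voter m where
  pos := v.pos.trans
    (Fin.cycleIcc ⟨(v.pos p : ℕ) - t, lt_of_le_of_lt (Nat.sub_le _ _) (v.pos p).isLt⟩ (v.pos p))
  approvals := v.approvals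

/-! ## Shift bribery -/

/-- An instance of shift bribery: `m` candidates, a list of `n` voters, for each voter `i` a
non-decreasing cost function on `{0, …, m}` with values in `ℕ ∪ {∞}` that vanishes at `0`, and the
designated candidate `p`. -/
structure ShiftBribery where
  m : ℕ
  n : ℕ
  p : Fin m
  votes : Election m n
  cost : Fin n → Fin (m + 1) → ℕ∞
  cost_zero : ∀ i, cost i 0 = 0
  cost_mono : ∀ i, Monotone (cost i)

namespace ShiftBribery

/-- A shift action: by how many positions `p` is shifted upwards in each vote. -/
abbrev Action (I : ShiftBribery) : Type := Fin I.n → Fin (I.m + 1)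

/-- The election after a shift action. -/
def shifted (I : ShiftBribery) (t : I.Action) : Election I.m I.n :=
  fun i => (I.votes i).shift I.p (t i)

/-- The cost of a shift action. -/
def totalCost (I : ShiftBribery) (t : I.Action) : ℕ∞ :=
  ∑ i, I.cost i (t i)

/-- `p` is a winner of the election after the shift action. -/
def Succeeds (R : VotingRule) (I : ShiftBribery) (t : I.Action) : Prop :=
  I.p ∈ R I.m I.n (I.shifted t)

/-- `t` makes `p` a winner, at the least cost among all shift actions that do. -/
def IsOptimal (R : VotingRule) (I : ShiftBribery) (t : I.Action) : Prop :=
  I.Succeeds R t ∧ ∀ s : I.Action, I.Succeeds R s → I.totalCost t ≤ I.totalCost s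

/-- The number that represents a cost: `0` for `∞` and `k + 1` for a finite cost `k`. -/
def encodeCost (x : ℕ∞) : ℕ :=
  if x = ⊤ then 0 else x.toNat + 1

/-- The block of the description that belongs to voter `i`: her candidates from the most to the
least preferred, her approval count, and the values of her cost function at `0, …, m`. -/
def encodeVoter (I : ShiftBribery) (i : Fin I.n) : List ℕ :=
  List.ofFn (fun j : Fin I.m => (((I.votes i).pos.symm j : Fin I.m) : ℕ)) ++
    [((I.votes i).approvals : ℕ)] ++ List.ofFn (fun j => encodeCost (I.cost i j))

/-- The description of an instance: `m`, `n`, `p`, and then the blocks of the voters. -/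
def encode (I : ShiftBribery) : List ℕ :=
  [I.m, I.n, (I.p : ℕ)] ++ (List.ofFn I.encodeVoter).flatten

/-- The description of a shift action: the list of its entries. -/
def encodeAction (I : ShiftBribery) (t : I.Action) : List ℕ :=
  List.ofFn fun i => (t i : ℕ)

end ShiftBribery

end Voting

/-! ## Programs with bounded loops

Programs all of whose loops run exactly `L` times, where `L` is the content of register `0` (the
length of the input). They have a functional semantics, and they run in polynomial time. -/

/-! A win of the designated candidate `p` is witnessed by one number `j`. For `j < m` the witness
says that `p` has a majority in round `j + 1` and nobody else has one in round `j`; any earlier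
majority can then only be one of `p` herself. For `j = m + y` with `y ≤ n / 2` it says that `p` has
at least `y` approvals and every other candidate at most `y`. Both have the same form: a lower bound
for the score of `p` in round `j + 1` and an upper bound for the other scores in round `j`
(`mem_simplifiedFallback_iff`).

Fix `j`, and consider the positions of a voter that count in round `j`. If `p` starts below them, a
shift either leaves the counted candidates unchanged or replaces the last of them by `p`; if `p`
starts among them, they never change. So each voter can take a point from at most one candidate,
known in advance, and the voters split into groups according to this candidate
(`truncScore_shifted_add`). The demands of different candidates concern disjoint groups, coupled
only through the points of `p` in round `j + 1`. A knapsack recursion over the groups therefore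
suffices: it stores the least cost for each number of points of `p` and each number of points lost
in the current group (`isTable_groups_len`). Its indices are score bounds and not costs, so the
tables are small although the costs are written in binary.

An optimal action is recovered from optimal values by self-reduction: each cost entry in turn is
raised to a prohibitive number whenever the optimum does not grow. The entries left affordable are
exactly those of one optimal action (`Data.search_spec`). The cost `∞` becomes a number above all
finite totals, and the prohibitive number lies above all totals formed with it. Since `p` wins from
the top of every vote (`succeeds_top`), the optimum is never prohibitive.

Polynomial time comes from the shape of the program: loops run once per input word, and without
multiplication each step lengthens numbers by a bounded number of bits (`reaches_run`). -/

namespace RAM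

/-- Programs with bounded loops: `loop x p` runs `p` with the values `0, …, L - 1` in register
`x`, where `L` is the content of register `0`. -/
inductive Prog where
  | skip
  | assign (x : ℕ) (e : Expr)
  | store (a : ℕ) (e₁ e₂ : Expr)
  | emit (e : Expr)
  | seq (p q : Prog)
  | cond (e : Expr) (p q : Prog)
  | loop (x : ℕ) (p : Prog)

namespace Prog

/-- Translation to the programs of the machine model. -/
def toCmd : Prog → Cmd
  | skip => .skip
  | assign x e => .assign x e
  | store a e₁ e₂ => .store a e₁ e₂
  | emit e => .emit e
  | seq p q => .seq p.toCmd q.toCmd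
  | cond e p q => .cond e p.toCmd q.toCmd
  | .loop x p => .seq (.assign x (.lit 0))
      (.loop (.sub (.var 0) (.var x)) (.seq p.toCmd (.assign x (.add (.var x) (.lit 1)))))

/-- The registers that a program may change. -/
def writesReg : Prog → ℕ → Bool
  | assign x _, y => x == y
  | seq p q, y => p.writesReg y || q.writesReg y
  | cond _ p q, y => p.writesReg y || q.writesReg y
  | .loop x p, y => x == y || p.writesReg y
  | _, _ => false

/-- The arrays that a program may change. -/
def writesArr : Prog → ℕ → Bool
  | store a _ _, b => a == b
  | seq p q, b => p.writesArr b || q.writesArr b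
  | cond _ p q, b => p.writesArr b || q.writesArr b
  | .loop _ p, b => p.writesArr b
  | _, _ => false

/-- Whether a program contains an output command. -/
def emits : Prog → Bool
  | emit _ => true
  | seq p q => p.emits || q.emits
  | cond _ p q => p.emits || q.emits
  | .loop _ p => p.emits
  | _ => false

/-- Register `0` is never changed, and the body of a loop does not change its counter. -/
def WellFormed : Prog → Bool
  | assign x _ => x != 0
  | seq p q => p.WellFormed && q.WellFormed
  | cond _ p q => p.WellFormed && q.WellFormed
  | .loop x p => x != 0 && !p.writesReg x && p.WellFormed
  | _ => true

/-- `iterate f k s` applies `f 0`, …, `f (k - 1)` to `s` in this order. -/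
def iterate (f : ℕ → State → State) : ℕ → State → State
  | 0, s => s
  | k + 1, s => f k (iterate f k s)

/-- The state after the run of a program. -/
def run : Prog → State → State
  | skip, s => s
  | assign x e, s => s.setReg x (e.eval s)
  | store a e₁ e₂, s => s.setArr a (e₁.eval s) (e₂.eval s)
  | emit e, s => { s with out := s.out ++ [e.eval s] }
  | seq p q, s => q.run (p.run s)
  | cond e p q, s => if e.eval s ≠ 0 then p.run s else q.run s
  | .loop x p, s =>
      (iterate (fun k s => p.run (s.setReg x k)) (s.reg 0) s).setReg x (s.reg 0)

end Prog

/-! ### Memory updates, and what a program leaves unchanged. -/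

@[simp] theorem State.setReg_reg (s : State) (x v y : ℕ) :
    (s.setReg x v).reg y = if y = x then v else s.reg y := by
  simp [State.setReg, Function.update_apply]

@[simp] theorem State.setReg_arr (s : State) (x v : ℕ) : (s.setReg x v).arr = s.arr := rfl

@[simp] theorem State.setReg_out (s : State) (x v : ℕ) : (s.setReg x v).out = s.out := rfl

@[simp] theorem State.setArr_reg (s : State) (a i v : ℕ) : (s.setArr a i v).reg = s.reg := rfl

@[simp] theorem State.setArr_arr (s : State) (a i v b j : ℕ) :
    (s.setArr a i v).arr b j = if b = a ∧ j = i then v else s.arr b j := by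
  by_cases h : b = a
  · subst h; simp [State.setArr, Function.update_apply]
  · simp [State.setArr, h]

@[simp] theorem State.setArr_out (s : State) (a i v : ℕ) : (s.setArr a i v).out = s.out := rfl

theorem State.setArr_arr_of_ne (s : State) {a b : ℕ} (i v : ℕ) (h : b ≠ a) :
    (s.setArr a i v).arr b = s.arr b := by
  funext j; simp [h]

namespace Prog

/-- `s'` agrees with `s` except where `p` may write. -/
structure Frame (p : Prog) (s s' : State) : Prop where
  reg : ∀ y, p.writesReg y = false → s'.reg y = s.reg y
  arr : ∀ a, p.writesArr a = false → s'.arr a = s.arr a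
  out : p.emits = false → s'.out = s.out

theorem Frame.refl (p : Prog) (s : State) : Frame p s s :=
  ⟨fun _ _ => rfl, fun _ _ => rfl, fun _ => rfl⟩

theorem Frame.trans {p : Prog} {s s' s'' : State} (h : Frame p s s') (h' : Frame p s' s'') :
    Frame p s s'' :=
  ⟨fun y hy => (h'.reg y hy).trans (h.reg y hy), fun a ha => (h'.arr a ha).trans (h.arr a ha),
    fun ho => (h'.out ho).trans (h.out ho)⟩

/-- The write predicates are computed from the syntax, so for concrete programs the side conditions
close by `rfl`; facts about the memory are carried past subprograms in this way throughout. -/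
theorem frame_run (p : Prog) (s : State) : Frame p s (p.run s) := by
  induction p generalizing s with
  | skip => exact Frame.refl _ _
  | assign x e =>
    refine ⟨fun y hy => ?_, fun _ _ => rfl, fun _ => rfl⟩
    have : y ≠ x := fun h => by simp [writesReg, h] at hy
    simp [run, this]
  | store a e₁ e₂ =>
    refine ⟨fun y _ => rfl, fun b hb => ?_, fun _ => rfl⟩
    have : b ≠ a := fun h => by simp [writesArr, h] at hb
    exact State.setArr_arr_of_ne _ _ _ this
  | emit e => exact ⟨fun _ _ => rfl, fun _ _ => rfl, fun h => by simp [emits] at h⟩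
  | seq p q hp hq =>
    refine ⟨fun y hy => ?_, fun b hb => ?_, fun ho => ?_⟩
    · simp only [writesReg, Bool.or_eq_false_iff] at hy
      exact ((hq _).reg y hy.2).trans ((hp s).reg y hy.1)
    · simp only [writesArr, Bool.or_eq_false_iff] at hb
      exact ((hq _).arr b hb.2).trans ((hp s).arr b hb.1)
    · simp only [emits, Bool.or_eq_false_iff] at ho
      exact ((hq _).out ho.2).trans ((hp s).out ho.1)
  | cond e p q hp hq =>
    refine ⟨fun y hy => ?_, fun b hb => ?_, fun ho => ?_⟩ <;> simp only [run] <;> split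
    all_goals simp only [writesReg, writesArr, emits, Bool.or_eq_false_iff] at *
    · exact (hp s).reg y hy.1
    · exact (hq s).reg y hy.2
    · exact (hp s).arr b hb.1
    · exact (hq s).arr b hb.2
    · exact (hp s).out ho.1
    · exact (hq s).out ho.2
  | loop x p hp =>
    have key : ∀ k, Frame (.loop x p) s (iterate (fun k s => p.run (s.setReg x k)) k s) := by
      intro k
      induction k with
      | zero => exact Frame.refl _ _
      | succ k ih =>
        refine ih.trans ⟨fun y hy => ?_, fun b hb => (hp _).arr b hb, fun ho => (hp _).out ho⟩
        simp only [writesReg, Bool.or_eq_false_iff, beq_eq_false_iff_ne, ne_eq] at hy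
        rw [iterate, (hp _).reg y hy.2]
        simp [Ne.symm hy.1]
    refine (key (s.reg 0)).trans ⟨fun y hy => ?_, fun _ _ => rfl, fun _ => rfl⟩
    simp only [writesReg, Bool.or_eq_false_iff, beq_eq_false_iff_ne, ne_eq] at hy
    simp [run, Ne.symm hy.1]

theorem Frame.loop {x : ℕ} {p : Prog} {s s' : State} (h : Frame p s s') :
    Frame (.loop x p) s s' := by
  refine ⟨fun y hy => h.reg y ?_, fun a ha => h.arr a ha, fun ho => h.out ho⟩
  simp only [writesReg, Bool.or_eq_false_iff] at hy
  exact hy.2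

/-- The invariant rule for loops. -/
theorem loop_induct {x : ℕ} {p : Prog} {s : State} (I : ℕ → State → Prop)
    (hset : ∀ k s' v, I k s' → I k (s'.setReg x v)) (h0 : I 0 s)
    (hstep : ∀ k s', k < s.reg 0 → Frame (.loop x p) s s' → s'.reg x = k → I k s' →
      I (k + 1) (p.run s')) :
    I (s.reg 0) ((Prog.loop x p).run s) := by
  -- The counter is overwritten before every iteration and once at the end, so the invariant must
  -- survive writes to it (`hset`). The frame gives each step access to what the loop does not
  -- touch.
  have key : ∀ k, k ≤ s.reg 0 →
      Frame (.loop x p) s (iterate (fun k s => p.run (s.setReg x k)) k s) ∧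
        I k (iterate (fun k s => p.run (s.setReg x k)) k s) := by
    intro k
    induction k with
    | zero => exact fun _ => ⟨Frame.refl _ _, h0⟩
    | succ k ih =>
      intro hk
      obtain ⟨hf, hI⟩ := ih (Nat.le_of_succ_le hk)
      have hset' : Frame (.loop x p) s
          ((iterate (fun k s => p.run (s.setReg x k)) k s).setReg x k) := by
        refine hf.trans ⟨fun y hy => ?_, fun _ _ => rfl, fun _ => rfl⟩
        simp only [writesReg, Bool.or_eq_false_iff, beq_eq_false_iff_ne, ne_eq] at hy
        simp [Ne.symm hy.1]
      refine ⟨hset'.trans ⟨fun y hy => ?_, fun b hb => (frame_run p _).arr b hb,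
        fun ho => (frame_run p _).out ho⟩, hstep k _ hk hset' (by simp) (hset _ _ _ hI)⟩
      simp only [writesReg, Bool.or_eq_false_iff] at hy
      exact (frame_run p _).reg y hy.2
  exact hset _ _ _ (key _ le_rfl).2

/-! ### Running times -/

/-- All numbers in the memory are at most `2 ^ b`. -/
def _root_.RAM.State.Bounded (s : State) (b : ℕ) : Prop :=
  (∀ x, s.reg x ≤ 2 ^ b) ∧ ∀ a i, s.arr a i ≤ 2 ^ b

theorem _root_.RAM.State.Bounded.mono {s : State} {b b' : ℕ} (h : s.Bounded b) (hb : b ≤ b') :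
    s.Bounded b' :=
  ⟨fun x => (h.1 x).trans (Nat.pow_le_pow_right two_pos hb),
    fun a i => (h.2 a i).trans (Nat.pow_le_pow_right two_pos hb)⟩

theorem _root_.RAM.State.Bounded.setReg {s : State} {b x v : ℕ} (h : s.Bounded b)
    (hv : v ≤ 2 ^ b) : (s.setReg x v).Bounded b := by
  refine ⟨fun y => ?_, h.2⟩
  rw [State.setReg_reg]
  split
  · exact hv
  · exact h.1 y

theorem _root_.RAM.State.Bounded.setArr {s : State} {b a i v : ℕ} (h : s.Bounded b)
    (hv : v ≤ 2 ^ b) : (s.setArr a i v).Bounded b := by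
  refine ⟨h.1, fun a' i' => ?_⟩
  rw [State.setArr_arr]
  split
  · exact hv
  · exact h.2 a' i'

/-- The size of an expression, with its literals counted in unary. -/
def _root_.RAM.Expr.weight : Expr → ℕ
  | .lit k => k + 1
  | .var _ => 1
  | .get _ e => e.weight + 1
  | .add e₁ e₂ => e₁.weight + e₂.weight + 1
  | .sub e₁ e₂ => e₁.weight + e₂.weight + 1

/-- An addition at most doubles the larger operand and a subtraction increases nothing, so the
exponent grows by at most the weight. -/
theorem _root_.RAM.Expr.eval_le {s : State} {b : ℕ} (h : s.Bounded b) (e : Expr) :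
    e.eval s ≤ 2 ^ (b + e.weight) := by
  induction e with
  | lit k =>
    exact (Nat.lt_two_pow_self (n := k)).le.trans
      (Nat.pow_le_pow_right two_pos (by simp only [Expr.weight]; omega))
  | var x => exact (h.1 x).trans (Nat.pow_le_pow_right two_pos (by omega))
  | get a e _ => exact (h.2 a _).trans (Nat.pow_le_pow_right two_pos (by omega))
  | add e₁ e₂ h₁ h₂ =>
    have h₁' := h₁.trans (Nat.pow_le_pow_right two_pos
      (show b + e₁.weight ≤ b + (e₁.weight + e₂.weight) by omega))
    have h₂' := h₂.trans (Nat.pow_le_pow_right two_pos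
      (show b + e₂.weight ≤ b + (e₁.weight + e₂.weight) by omega))
    simp only [Expr.eval, Expr.weight, ← add_assoc, pow_succ] at *
    omega
  | sub e₁ e₂ h₁ _ =>
    exact (Nat.sub_le _ _).trans (h₁.trans
      (Nat.pow_le_pow_right two_pos (by simp only [Expr.weight]; omega)))

theorem _root_.RAM.Expr.cost_le {s : State} {b : ℕ} (h : s.Bounded b) (e : Expr) :
    e.cost s ≤ e.weight * (b + e.weight + 2) := by
  have size_le : ∀ e : Expr, 1 + (e.eval s).size ≤ b + e.weight + 2 := by
    intro e
    have : (e.eval s).size ≤ b + e.weight + 1 :=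
      Nat.size_le.2 ((e.eval_le h).trans_lt (Nat.pow_lt_pow_right one_lt_two (by omega)))
    omega
  induction e with
  | lit k =>
    have := size_le (.lit k)
    simp only [Expr.cost, Expr.weight, Expr.eval] at *
    nlinarith
  | var x =>
    have := size_le (.var x)
    simp only [Expr.cost, Expr.weight, Expr.eval] at *
    omega
  | get a e ih =>
    have := size_le (.get a e)
    simp only [Expr.cost, Expr.weight, Expr.eval] at *
    nlinarith
  | add e₁ e₂ h₁ h₂ =>
    have := size_le (.add e₁ e₂)
    simp only [Expr.cost, Expr.weight, Expr.eval] at *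
    nlinarith
  | sub e₁ e₂ h₁ h₂ =>
    have := size_le (.sub e₁ e₂)
    simp only [Expr.cost, Expr.weight, Expr.eval] at *
    nlinarith

/-- A bound for the number of steps of a program with `l` iterations of each loop. -/
def steps : Prog → ℕ → ℕ
  | skip, _ => 1
  | assign _ e, _ => e.weight + 3
  | store _ e₁ e₂, _ => e₁.weight + e₂.weight + 3
  | emit e, _ => e.weight + 3
  | seq p q, l => p.steps l + q.steps l + 1
  | cond e p q, l => p.steps l + q.steps l + e.weight + 3
  | .loop _ p, l => l * (p.steps l + 20) + 20

theorem steps_mono (p : Prog) : Monotone p.steps := by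
  intro l l' h
  induction p with
  | seq p q hp hq => simp only [steps]; omega
  | cond e p q hp hq => simp only [steps]; omega
  | loop x p hp =>
    exact Nat.add_le_add_right (Nat.mul_le_mul h (Nat.add_le_add_right hp _)) _
  | _ => exact le_rfl

theorem exists_polynomial_steps (p : Prog) : ∃ q : Polynomial ℕ, ∀ l, p.steps l = q.eval l := by
  induction p with
  | skip => exact ⟨1, fun l => by simp [steps]⟩
  | assign x e => exact ⟨.C (e.weight + 3), fun l => by simp only [steps, Polynomial.eval_C]⟩
  | store a e₁ e₂ =>
    exact ⟨.C (e₁.weight + e₂.weight + 3), fun l => by simp only [steps, Polynomial.eval_C]⟩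
  | emit e => exact ⟨.C (e.weight + 3), fun l => by simp only [steps, Polynomial.eval_C]⟩
  | seq p q hp hq =>
    obtain ⟨a, ha⟩ := hp
    obtain ⟨b, hb⟩ := hq
    exact ⟨a + b + 1, fun l => by simp [steps, ha, hb]⟩
  | cond e p q hp hq =>
    obtain ⟨a, ha⟩ := hp
    obtain ⟨b, hb⟩ := hq
    exact ⟨a + b + .C (e.weight + 3), fun l => by
      simp only [steps, ha, hb, Polynomial.eval_add, Polynomial.eval_C, add_assoc]⟩
  | loop x p hp =>
    obtain ⟨a, ha⟩ := hp
    exact ⟨.X * (a + .C 20) + .C 20, fun l => by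
      simp only [steps, ha, Polynomial.eval_add, Polynomial.eval_C, Polynomial.eval_mul,
        Polynomial.eval_X]⟩

theorem reg_zero_run (p : Prog) (hp : p.WellFormed = true) (s : State) :
    (p.run s).reg 0 = s.reg 0 := by
  have : p.writesReg 0 = false := by
    induction p with
    | assign x e => simpa [WellFormed, writesReg] using hp
    | seq p q ihp ihq =>
      simp only [WellFormed, Bool.and_eq_true] at hp
      simp [writesReg, ihp hp.1, ihq hp.2]
    | cond e p q ihp ihq =>
      simp only [WellFormed, Bool.and_eq_true] at hp
      simp [writesReg, ihp hp.1, ihq hp.2]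
    | loop x p ih =>
      simp only [WellFormed, Bool.and_eq_true, bne_iff_ne] at hp
      simp [writesReg, ih hp.2, hp.1.1]
    | _ => rfl
  exact (frame_run p s).reg 0 this

/-- From memories bounded by `2 ^ b`, the command `c` takes `s` to `s'` with at most `u` steps. -/
def Reaches (c : Cmd) (s s' : State) (b u : ℕ) : Prop :=
  s'.Bounded (b + u) ∧ ∃ k, Exec c s s' k ∧ k ≤ u * (b + u)

/-- One parameter `u` controls bit lengths and cost together, because `1 + u₁ * (b + u₁) + u₂ * (b +
u₁ + u₂)` is at most `(u₁ + u₂ + 1) * (b + u₁ + u₂ + 1)`. -/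
theorem Reaches.seq {c₁ c₂ : Cmd} {s s' s'' : State} {b u₁ u₂ : ℕ} (h₁ : Reaches c₁ s s' b u₁)
    (h₂ : Reaches c₂ s' s'' (b + u₁) u₂) : Reaches (.seq c₁ c₂) s s'' b (u₁ + u₂ + 1) := by
  obtain ⟨-, k₁, e₁, l₁⟩ := h₁
  obtain ⟨b₂, k₂, e₂, l₂⟩ := h₂
  refine ⟨b₂.mono (by omega), _, .seq e₁ e₂, ?_⟩
  nlinarith

theorem Reaches.mono {c : Cmd} {s s' : State} {b u u' : ℕ} (h : Reaches c s s' b u)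
    (hu : u ≤ u') : Reaches c s s' b u' :=
  ⟨h.1.mono (by omega), h.2.imp fun _ hk =>
    ⟨hk.1, hk.2.trans (Nat.mul_le_mul hu (by omega))⟩⟩

theorem reaches_assign {s : State} {b : ℕ} (hb : s.Bounded b) (x : ℕ) (e : Expr) :
    Reaches (.assign x e) s (s.setReg x (e.eval s)) b (e.weight + 3) := by
  refine ⟨((hb.mono (Nat.le_add_right _ _)).setReg (e.eval_le hb)).mono (by omega), _,
    .assign x e s, ?_⟩
  have := e.cost_le hb
  nlinarith

theorem reaches_run (p : Prog) (hp : p.WellFormed = true) {s : State} {b : ℕ}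
    (hb : s.Bounded b) : Reaches p.toCmd s (p.run s) b (p.steps (s.reg 0)) := by
  induction p generalizing s b with
  | skip => exact ⟨hb.mono (by omega), _, .skip s, by simp [steps]⟩
  | assign x e => exact reaches_assign hb x e
  | store a e₁ e₂ =>
    refine ⟨((hb.mono (Nat.le_add_right _ _)).setArr (e₂.eval_le hb)).mono
      (by simp only [steps]; omega), _, .store a e₁ e₂ s, ?_⟩
    have h₁ := e₁.cost_le hb
    have h₂ := e₂.cost_le hb
    simp only [steps]
    nlinarith
  | emit e =>
    refine ⟨hb.mono (by omega), _, .emit e s, ?_⟩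
    have := e.cost_le hb
    simp only [steps]
    nlinarith
  | seq p q ihp ihq =>
    simp only [WellFormed, Bool.and_eq_true] at hp
    have h0 : (p.run s).reg 0 = s.reg 0 := reg_zero_run p hp.1 s
    have h₁ := ihp hp.1 hb
    have h₂ := ihq hp.2 h₁.1
    rw [h0] at h₂
    exact h₁.seq h₂
  | cond e p q ihp ihq =>
    simp only [WellFormed, Bool.and_eq_true] at hp
    have hc := e.cost_le hb
    by_cases he : e.eval s = 0
    · obtain ⟨hb', k, hk, hle⟩ := ihq hp.2 hb
      simp only [run, steps, he, ne_eq, not_true_eq_false, if_false, toCmd]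
      refine ⟨hb'.mono (by omega), _, .cond_false he hk, ?_⟩
      nlinarith
    · obtain ⟨hb', k, hk, hle⟩ := ihp hp.1 hb
      simp only [run, steps, he, ne_eq, not_false_eq_true, if_true, toCmd]
      refine ⟨hb'.mono (by omega), _, .cond_true he hk, ?_⟩
      nlinarith
  | loop x p ih =>
    simp only [WellFormed, Bool.and_eq_true, Bool.not_eq_true', bne_iff_ne] at hp
    obtain ⟨⟨hx, hpx⟩, hp⟩ := hp
    set l := s.reg 0 with hl
    -- `σ k` is the memory at the test before iteration `k`. The functional semantics sets the
    -- counter to `k`; the machine obtains the same value by its increment.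
    set σ : ℕ → State := fun k => (iterate (fun k s => p.run (s.setReg x k)) k s).setReg x k
      with hσ
    have hσ0 : ∀ k, (σ k).reg 0 = l := by
      intro k
      simp only [hσ, State.setReg_reg, Ne.symm hx, if_false]
      induction k with
      | zero => rfl
      | succ k ih' =>
        rw [iterate, reg_zero_run p hp]
        simpa [Ne.symm hx] using ih'
    have hσx : ∀ k, (σ k).reg x = k := fun k => by simp [hσ]
    have hσs : ∀ k, σ (k + 1) = (p.run (σ k)).setReg x (k + 1) := fun k => rfl
    -- Here `r` is the number of iterations left. The increment takes 7 steps, sequencing one, and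
    -- the test has weight 3; the constant 20 leaves room for all of them.
    have main : ∀ r k b, k + r = l → (σ k).Bounded b →
        Reaches (.loop (.sub (.var 0) (.var x)) (.seq p.toCmd
          (.assign x (.add (.var x) (.lit 1))))) (σ k) (σ l) b (r * (p.steps l + 20) + 10) := by
      intro r
      induction r with
      | zero =>
        intro k b hk hbk
        obtain rfl : k = l := by omega
        have hc := (Expr.sub (.var 0) (.var x)).cost_le hbk
        refine ⟨hbk.mono (by omega), _, .loop_false (by simp [Expr.eval, hσ0, hσx]), ?_⟩
        simp only [Expr.weight] at hc
        nlinarith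
      | succ r ih' =>
        intro k b hk hbk
        have hc := (Expr.sub (.var 0) (.var x)).cost_le hbk
        have h₁ := ih hp hbk
        rw [hσ0] at h₁
        have h₂ := reaches_assign h₁.1 x (.add (.var x) (.lit 1))
        have hev : (Expr.add (.var x) (.lit 1)).eval (p.run (σ k)) = k + 1 := by
          simp [Expr.eval, (frame_run p _).reg x hpx, hσx]
        rw [hev, ← hσs] at h₂
        obtain ⟨hb₁, k₁, he₁, hle₁⟩ := h₁.seq h₂
        obtain ⟨hb₂, k₂, he₂, hle₂⟩ := ih' (k + 1) _ (by omega) hb₁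
        refine ⟨hb₂.mono ?_, _, .loop_true ?_ he₁ he₂, ?_⟩
        · simp only [Expr.weight]
          nlinarith
        · simp only [Expr.eval, hσ0, hσx]; omega
        · simp only [Expr.weight] at hc hle₁ hle₂
          have hv : (r + 1) * (p.steps l + 20) + 10 =
              (r * (p.steps l + 20) + 10) + (p.steps l + 20) := by ring
          rw [hv]
          generalize r * (p.steps l + 20) + 10 = v at hle₂ ⊢
          generalize p.steps l = u at *
          nlinarith
    have h₁ := reaches_assign hb x (.lit 0)
    have h₂ := main l 0 _ (zero_add l) h₁.1
    have := h₁.seq h₂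
    exact this.mono (by simp only [steps, Expr.weight]; omega)

end Prog

/-! ### From the initial memory to a polynomial time bound. -/

theorem size_add_one_le_bitLength {w : List ℕ} {x : ℕ} (hx : x ∈ w) :
    x.size + 1 ≤ bitLength w :=
  List.single_le_sum (by simp) _ (List.mem_map.2 ⟨x, hx, rfl⟩)

theorem length_le_bitLength (w : List ℕ) : w.length ≤ bitLength w := by
  induction w with
  | nil => simp
  | cons x w ih =>
    simp only [bitLength, List.length_cons, List.map_cons, List.sum_cons] at *
    omega

theorem bounded_init (w : List ℕ) : (init w).Bounded (bitLength w) := by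
  refine ⟨fun x => ?_, fun a i => ?_⟩
  · by_cases hx : x = 0
    · simpa [init, hx] using (length_le_bitLength w).trans Nat.lt_two_pow_self.le
    · simp [init, hx]
  · by_cases ha : a = 0 ∧ i < w.length
    · have := size_add_one_le_bitLength (List.getElem_mem ha.2)
      simpa [init, ha.1, ha.2] using
        (Nat.lt_size_self _).le.trans (Nat.pow_le_pow_right two_pos (by omega))
    · by_cases ha' : a = 0
      · have : w.length ≤ i := not_lt.1 fun h => ha ⟨ha', h⟩
        simp [init, ha', this]
      · simp [init, ha']

/-- A program with bounded loops that answers every instance correctly witnesses that the problem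
is solvable in polynomial time. -/
theorem solvableInPolyTime_of_prog {α : Type} {β : α → Type} {encIn : α → List ℕ}
    {encOut : (a : α) → β a → List ℕ} {Sol : (a : α) → β a → Prop} (p : Prog)
    (hp : p.WellFormed = true)
    (h : ∀ a, ∃ b, (p.run (init (encIn a))).out = encOut a b ∧ Sol a b) :
    SolvableInPolyTime encIn encOut Sol := by
  obtain ⟨q, hq⟩ := p.exists_polynomial_steps
  -- This is the bound `u * (b + u)` with `b` the description length, which also bounds the number
  -- of iterations of each loop.
  refine ⟨p.toCmd, q * (.X + q), fun a => ?_⟩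
  obtain ⟨b, hout, hsol⟩ := h a
  obtain ⟨-, k, hk, hle⟩ := Prog.reaches_run p hp (bounded_init (encIn a))
  refine ⟨b, _, k, hk, ?_, hout, hsol⟩
  have hs : p.steps ((init (encIn a)).reg 0) ≤ q.eval (bitLength (encIn a)) := by
    rw [← hq]
    exact p.steps_mono (by simpa [init] using length_le_bitLength _)
  simp only [Polynomial.eval_mul, Polynomial.eval_add, Polynomial.eval_X]
  exact hle.trans (Nat.mul_le_mul hs (Nat.add_le_add_left hs _))

end RAM

/-! ## The dynamic program

Registers: `0` input length, `1` number of candidates, `2` number of voters, `3` designated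
candidate, `4` half the number of voters, `6` bound for the costs, `10` round, `11` target, `12` cap,
`13` candidate, `14` demand, `15` voter, `17` and `18` numbers of positions that count, `19` group,
`20` and `21` indices of the table, `22` entry of the table, `26` value. Arrays: `0` input, `1`
costs, `2` block addresses, `3` positions of the designated candidate, `6` row addresses of the
table, `7` table, `8` new table. -/

namespace Voting.Bribery

open RAM RAM.Prog

/-- The least of `b` and the numbers `f 0`, …, `f (k - 1)`. -/
def runMin (b : ℕ) (f : ℕ → ℕ) : ℕ → ℕ
  | 0 => b
  | k + 1 => min (runMin b f k) (f k)

/-- An instance of shift bribery as the program sees it: the input length `len`, the numbers of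
candidates and voters, the designated candidate, `half = n / 2`, a number `inf` that exceeds all
finite costs, for each voter the address `base` of her block, her candidates `ord` by position, the
number `app` of candidates that she approves of, and the position `pp` of the designated
candidate. -/
structure Data where
  len : ℕ
  m : ℕ
  n : ℕ
  p : ℕ
  half : ℕ
  inf : ℕ
  base : ℕ → ℕ
  ord : ℕ → ℕ → ℕ
  app : ℕ → ℕ
  pp : ℕ → ℕ

namespace Data

variable (D : Data)

/-- Whether voter `i` counts `D.p` in round `j` after a shift by `t`. -/
def point (j i t : ℕ) : ℕ := min 1 (min j (D.app i) - (D.pp i - t))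

/-- The candidate who loses her point in round `j` when voter `i` starts to count `D.p`; it is
`D.p` if there is no such candidate. -/
def group (j i : ℕ) : ℕ :=
  if min j (D.app i) ≠ 0 ∧ min j (D.app i) ≤ D.pp i then D.ord i (min j (D.app i) - 1) else D.p

/-- The score of `c` in round `j` before the shifts. -/
def score (j c : ℕ) : ℕ :=
  ∑ i ∈ Finset.range D.len, if i < D.n then
    ∑ x ∈ Finset.range D.len, if x < min j (D.app i) ∧ D.ord i x = c then 1 else 0 else 0

/-- The number of points that `c` has to lose in round `j` to keep at most `y` of them. -/
def need (j y c : ℕ) : ℕ := if c = D.p then 0 else D.score j c - y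

/-- The score that `D.p` needs in round `j + 1`. -/
def target (j : ℕ) : ℕ :=
  if j < D.m then D.half + 1 else if j - D.m ≤ D.half then j - D.m else D.half + 1

/-- The score that the other candidates may have in round `j`. -/
def cap (j : ℕ) : ℕ :=
  if j < D.m then D.half else if j - D.m ≤ D.half then j - D.m else D.half

/-- The cost of a shift by `t` in the vote of `i`, if `C` is the array of costs. -/
def cost (C : ℕ → ℕ) (i t : ℕ) : ℕ := C (D.base i + (D.m + 1 + t))

/-- The update of the table for voter `i`. Tables give the least cost of reaching `g` points for
`D.p` and `d` lost points in the current group. -/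
def voterStep (C : ℕ → ℕ) (j i : ℕ) (F : ℕ → ℕ → ℕ) (g d : ℕ) : ℕ :=
  runMin D.inf (fun t => if t ≤ D.m then
    D.cost C i t + F (g - D.point (j + 1) i t) (d - D.point j i t) else D.inf) D.len

/-- The table after the voters below `k` in the group of `c`. -/
def voters (C : ℕ → ℕ) (j c : ℕ) (F : ℕ → ℕ → ℕ) : ℕ → ℕ → ℕ → ℕ
  | 0 => F
  | i + 1 => if i < D.n ∧ D.group j i = c then D.voterStep C j i (voters C j c F i)
      else voters C j c F i

/-- The end of a group with demand `e`. -/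
def close (e : ℕ) (F : ℕ → ℕ → ℕ) (g d : ℕ) : ℕ := if d = 0 then F g e else D.inf

/-- The table after the groups of the candidates below `k`. -/
def groups (C : ℕ → ℕ) (j : ℕ) : ℕ → ℕ → ℕ → ℕ
  | 0 => fun g d => if g + d = 0 then 0 else D.inf
  | c + 1 => if c < D.m then
      D.close (D.need j (D.cap j) c) (D.voters C j c (groups C j c) D.len) else groups C j c

/-- The least cost of making `D.p` a winner. -/
def value (C : ℕ → ℕ) : ℕ :=
  runMin D.inf (fun j => D.groups C j D.len (D.target j) 0) D.len

/-- The memory holds the data `D`. -/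
structure Ready (s : State) : Prop where
  len : s.reg 0 = D.len
  m : s.reg 1 = D.m
  n : s.reg 2 = D.n
  p : s.reg 3 = D.p
  half : s.reg 4 = D.half
  inf : s.reg 6 = D.inf
  base : ∀ i < D.len, s.arr 2 i = D.base i
  ord : ∀ i < D.len, ∀ x, s.arr 0 (D.base i + x) = D.ord i x
  app : ∀ i < D.len, s.arr 0 (D.base i + D.m) = D.app i
  pp : ∀ i < D.len, s.arr 3 i = D.pp i
  row : ∀ g < D.len, s.arr 6 g = g * D.len

/-- Array `7` holds the table `F`. -/
def Table (F : ℕ → ℕ → ℕ) (s : State) : Prop :=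
  ∀ g < D.len, ∀ d < D.len, s.arr 7 (g * D.len + d) = F g d

end Data

/-! ### Expressions and subprograms of the dynamic program. -/

instance : Add Expr := ⟨.add⟩
instance : Sub Expr := ⟨.sub⟩

@[simp] theorem eval_add (s : State) (a b : Expr) : (a + b).eval s = a.eval s + b.eval s := rfl
@[simp] theorem eval_sub (s : State) (a b : Expr) : (a - b).eval s = a.eval s - b.eval s := rfl

/-- The minimum of two expressions. -/
def minE (a b : Expr) : Expr := a - (a - b)

@[simp] theorem eval_minE (s : State) (a b : Expr) :
    (minE a b).eval s = min (a.eval s) (b.eval s) :=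
  Nat.sub_sub_eq_min _ _

/-- The cell `x` of the block of the voter in register `15`. -/
def block (a : ℕ) (x : Expr) : Expr := .get a (.get 2 (.var 15) + x)

@[simp] theorem eval_block (s : State) (a : ℕ) (x : Expr) :
    (block a x).eval s = s.arr a (s.arr 2 (s.reg 15) + x.eval s) := rfl

/-- Puts the results of `body` in register `22`, for `g` and `d` in the registers `20` and `21`, into
the table in array `a`. -/
def fill (a : ℕ) (body : Prog) : Prog :=
  .loop 20 <| .loop 21 <| .seq body (.store a (.get 6 (.var 20) + .var 21) (.var 22))

/-- Replaces the table by the results of `body`. -/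
def tabulate (body : Prog) : Prog :=
  .seq (fill 8 body) (fill 7 (.assign 22 (.get 8 (.get 6 (.var 20) + .var 21))))

/-- Computes the demand of the candidate in register `13` in register `14`. -/
def needProg : Prog :=
  .seq (.assign 14 (.lit 0)) <|
  .seq (.loop 15 <| .cond (.var 2 - .var 15)
    (.seq (.assign 17 (minE (.var 10) (block 0 (.var 1)))) <|
      .loop 16 <| .cond (.var 17 - .var 16)
        (.cond ((block 0 (.var 16) - .var 13) + (.var 13 - block 0 (.var 16))) .skip
          (.assign 14 (.var 14 + .lit 1))) .skip) .skip) <|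
  .seq (.assign 14 (.var 14 - .var 12)) <|
  .cond ((.var 13 - .var 3) + (.var 3 - .var 13)) .skip (.assign 14 (.lit 0))

/-- Computes an entry of the new table for the voter in register `15`. -/
def voterBody : Prog :=
  .seq (.assign 22 (.var 6)) <|
  .loop 23 <| .cond (.var 1 + .lit 1 - .var 23)
    (.assign 22 (minE (.var 22) (block 1 (.var 1 + .lit 1 + .var 23) +
      .get 7 (.get 6 (.var 20 - minE (.lit 1) (.var 18 - (.get 3 (.var 15) - .var 23))) +
        (.var 21 - minE (.lit 1) (.var 17 - (.get 3 (.var 15) - .var 23))))))) .skip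

/-- For the voter in register `15`, puts the numbers of positions that count in the round of register
`10` and in the next one into the registers `17` and `18`, and the group into register `19`. -/
def levelProg : Prog :=
  .seq (.assign 17 (minE (.var 10) (block 0 (.var 1)))) <|
  .seq (.assign 18 (minE (.var 10 + .lit 1) (block 0 (.var 1)))) <|
  .seq (.assign 19 (.var 3)) <|
  .cond (.var 17) (.cond (.get 3 (.var 15) + .lit 1 - .var 17)
    (.assign 19 (block 0 (.var 17 - .lit 1))) .skip) .skip

/-- Updates the table for the voter in register `15` if she is in the group of the candidate in
register `13`. -/
def voterProg : Prog :=
  .cond (.var 2 - .var 15)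
    (.seq levelProg <|
      .cond ((.var 19 - .var 13) + (.var 13 - .var 19)) .skip (tabulate voterBody)) .skip

/-- Computes an entry of the table at the end of a group with the demand in register `14`. -/
def closeBody : Prog :=
  .seq (.assign 22 (.var 6)) <|
  .cond (.var 21) .skip (.assign 22 (.get 7 (.get 6 (.var 20) + .var 14)))

/-- Computes an entry of the initial table. -/
def startBody : Prog :=
  .seq (.assign 22 (.var 6)) <| .cond (.var 20 + .var 21) .skip (.assign 22 (.lit 0))

/-- Processes the group of the candidate in register `13`. -/
def groupProg : Prog :=
  .cond (.var 1 - .var 13)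
    (.seq needProg <| .seq (.loop 15 voterProg) (tabulate closeBody)) .skip

/-- Puts the target and the cap for the round in register `10` into the registers `11` and `12`. -/
def targetProg : Prog :=
  .seq (.assign 11 (.var 4 + .lit 1)) <| .seq (.assign 12 (.var 4)) <|
  .cond (.var 1 - .var 10) .skip <|
  .cond (.var 4 + .lit 1 - (.var 10 - .var 1))
    (.seq (.assign 11 (.var 10 - .var 1)) (.assign 12 (.var 10 - .var 1))) .skip

/-- Computes the least cost of making the designated candidate a winner in register `26`. -/
def valueProg : Prog :=
  .seq (.assign 26 (.var 6)) <|
  .loop 10 <|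
    .seq targetProg <| .seq (tabulate startBody) <| .seq (.loop 13 groupProg) <|
    .assign 26 (minE (.var 26) (.get 7 (.get 6 (.var 11))))

/-! ### Specifications of the subprograms of the dynamic program. -/

/-- `p` does not change the data of the instance. -/
def Local (p : Prog) : Bool :=
  !(p.writesReg 0 || p.writesReg 1 || p.writesReg 2 || p.writesReg 3 || p.writesReg 4 ||
    p.writesReg 6 || p.writesArr 0 || p.writesArr 2 || p.writesArr 3 || p.writesArr 6)

theorem Data.Ready.of_frame {D : Data} {p : Prog} {s s' : State} (h : D.Ready s)
    (hf : Frame p s s') (hp : Local p = true) : D.Ready s' := by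
  simp only [Local, Bool.not_eq_true', Bool.or_eq_false_iff] at hp
  obtain ⟨⟨⟨⟨⟨⟨⟨⟨⟨h0, h1⟩, h2⟩, h3⟩, h4⟩, h6⟩, a0⟩, a2⟩, a3⟩, a6⟩ := hp
  refine ⟨?_, ?_, ?_, ?_, ?_, ?_, ?_, ?_, ?_, ?_, ?_⟩
  · rw [hf.reg _ h0, h.len]
  · rw [hf.reg _ h1, h.m]
  · rw [hf.reg _ h2, h.n]
  · rw [hf.reg _ h3, h.p]
  · rw [hf.reg _ h4, h.half]
  · rw [hf.reg _ h6, h.inf]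
  · rw [hf.arr _ a2]; exact h.base
  · rw [hf.arr _ a0]; exact h.ord
  · rw [hf.arr _ a0]; exact h.app
  · rw [hf.arr _ a3]; exact h.pp
  · rw [hf.arr _ a6]; exact h.row

theorem Data.Ready.setReg {D : Data} {s : State} (h : D.Ready s) {x v : ℕ} (hx : 6 < x) :
    D.Ready (s.setReg x v) := by
  have hne : ∀ y, y ≤ 6 → (s.setReg x v).reg y = s.reg y := fun y hy => by
    rw [State.setReg_reg, if_neg (by omega)]
  exact ⟨by rw [hne _ (by norm_num), h.len], by rw [hne _ (by norm_num), h.m],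
    by rw [hne _ (by norm_num), h.n], by rw [hne _ (by norm_num), h.p],
    by rw [hne _ (by norm_num), h.half], by rw [hne _ (by norm_num), h.inf],
    h.base, h.ord, h.app, h.pp, h.row⟩

/-- Uniqueness of quotient and remainder: distinct table entries, and later distinct cost entries,
lie in distinct cells. -/
theorem row_add_inj {L g d g' d' : ℕ} (hd : d < L) (hd' : d' < L) :
    g * L + d = g' * L + d' ↔ g = g' ∧ d = d' := by
  refine ⟨fun h => ?_, fun h => by rw [h.1, h.2]⟩
  have hL : 0 < L := by omega
  have h₁ : (g * L + d) / L = g := by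
    rw [Nat.add_comm, Nat.add_mul_div_right _ _ hL, Nat.div_eq_of_lt hd, zero_add]
  have h₂ : (g' * L + d') / L = g' := by
    rw [Nat.add_comm, Nat.add_mul_div_right _ _ hL, Nat.div_eq_of_lt hd', zero_add]
  have : g = g' := by rw [← h₁, ← h₂, h]
  subst this
  exact ⟨rfl, by omega⟩

/-- The frame in the hypothesis on `body` allows any content of array `a`, so an entry cannot depend
on the cells already filled. -/
theorem fill_spec {D : Data} {s : State} {a : ℕ} {body : Prog} {F : ℕ → ℕ → ℕ} (hs : D.Ready s)
    (hl : Local (fill a body) = true) (h20 : body.writesReg 20 = false)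
    (h21 : body.writesReg 21 = false) (ha : body.writesArr a = false)
    (h : ∀ s' g d, g < D.len → d < D.len → Frame (fill a body) s s' → s'.reg 20 = g →
      s'.reg 21 = d → (body.run s').reg 22 = F g d) :
    ∀ g < D.len, ∀ d < D.len, ((fill a body).run s).arr a (g * D.len + d) = F g d := by
  have := loop_induct (x := 20)
    (p := .loop 21 <| .seq body (.store a (.get 6 (.var 20) + .var 21) (.var 22))) (s := s)
    (fun k s' => ∀ g < k, ∀ d < D.len, s'.arr a (g * D.len + d) = F g d)
    (fun k s' v hI => by simpa using hI) (by simp) ?_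
  · rw [hs.len] at this
    exact this
  intro g s' hg hf h20' hI
  rw [hs.len] at hg
  have hs' : D.Ready s' := hs.of_frame hf hl
  have := loop_induct (x := 21)
    (p := .seq body (.store a (.get 6 (.var 20) + .var 21) (.var 22))) (s := s')
    (fun k s'' => (∀ g' < g, ∀ d < D.len, s''.arr a (g' * D.len + d) = F g' d) ∧
      ∀ d < k, s''.arr a (g * D.len + d) = F g d)
    (fun k s' v hI => by simpa using hI) ⟨hI, by simp⟩ ?_
  · rw [hs'.len] at this
    intro g' hg' d hd
    rcases Nat.lt_succ_iff_lt_or_eq.1 hg' with h | rfl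
    · exact this.1 g' h d hd
    · exact this.2 d hd
  intro d s'' hd hf' h21' ⟨hI₁, hI₂⟩
  rw [hs'.len] at hd
  have hf'' : Frame (fill a body) s s'' := hf.trans hf'.loop
  have hs'' : D.Ready s'' := hs.of_frame hf'' hl
  have h20'' : s''.reg 20 = g := by
    rw [← h20']
    exact hf'.reg 20 (by simp [writesReg, h20])
  have hb := frame_run body s''
  have key : (Prog.run (.seq body (.store a (.get 6 (.var 20) + .var 21) (.var 22))) s'') =
      (body.run s'').setArr a (g * D.len + d) (F g d) := by
    have h6 : body.writesArr 6 = false := by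
      simp only [Local, fill, writesArr, Bool.not_eq_true', Bool.or_eq_false_iff] at hl
      exact hl.2.1
    simp only [run, Expr.eval]
    rw [h s'' g d hg hd hf'' h20'' h21', hb.arr 6 h6, hb.reg 20 h20, hb.reg 21 h21, h20'', h21',
      hs''.row g hg]
  rw [key]
  refine ⟨fun g' hg' d' hd' => ?_, fun d' hd' => ?_⟩
  · rw [State.setArr_arr, if_neg, hb.arr a ha, hI₁ g' hg' d' hd']
    rintro ⟨-, h⟩
    have := ((row_add_inj hd' hd).1 h).1
    omega
  · rw [State.setArr_arr]
    by_cases hdd : d' = d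
    · simp [hdd]
    · rw [if_neg, hb.arr a ha, hI₂ d' (by omega)]
      rintro ⟨-, h⟩
      omega

/-- New entries refer to old entries in other places, so the new table is completed in array `8`
before it replaces the old one in array `7`. -/
theorem tabulate_spec {D : Data} {s : State} {body : Prog} {F : ℕ → ℕ → ℕ} (hs : D.Ready s)
    (hl : Local (fill 8 body) = true) (h20 : body.writesReg 20 = false)
    (h21 : body.writesReg 21 = false) (ha : body.writesArr 8 = false)
    (h : ∀ s' g d, g < D.len → d < D.len → Frame (fill 8 body) s s' → s'.reg 20 = g →
      s'.reg 21 = d → (body.run s').reg 22 = F g d) :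
    D.Table F ((tabulate body).run s) := by
  have h₁ := fill_spec hs hl h20 h21 ha h
  have hs' : D.Ready ((fill 8 body).run s) := hs.of_frame (frame_run _ _) hl
  refine fill_spec hs' rfl rfl rfl rfl fun s' g d hg hd hf hg' hd' => ?_
  have hs'' := hs'.of_frame hf rfl
  simp only [run, Expr.eval, State.setReg_reg, if_true, hg', hd', hs''.row g hg]
  rw [hf.arr 8 rfl, h₁ g hg d hd]

variable {D : Data}

theorem Data.Table.of_frame {F : ℕ → ℕ → ℕ} {p : Prog} {s s' : State} (h : D.Table F s)
    (hf : Frame p s s') (hp : p.writesArr 7 = false) : D.Table F s' := by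
  unfold Data.Table
  rw [hf.arr 7 hp]
  exact h

theorem runMin_le_base (b : ℕ) (f : ℕ → ℕ) (k : ℕ) : runMin b f k ≤ b := by
  induction k with
  | zero => exact le_rfl
  | succ k ih => exact (min_le_left _ _).trans ih

theorem voterBody_spec {s : State} {F : ℕ → ℕ → ℕ} {C : ℕ → ℕ} {i j g d : ℕ} (hs : D.Ready s)
    (hT : D.Table F s) (hC : s.arr 1 = C) (hi : i < D.len) (hg : g < D.len) (hd : d < D.len)
    (h15 : s.reg 15 = i) (h17 : s.reg 17 = min j (D.app i))
    (h18 : s.reg 18 = min (j + 1) (D.app i)) (h20 : s.reg 20 = g) (h21 : s.reg 21 = d) :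
    (voterBody.run s).reg 22 = D.voterStep C j i F g d := by
  have := loop_induct (x := 23) (s := s.setReg 22 (s.reg 6))
    (fun k s' => s'.reg 22 = runMin D.inf (fun t => if t ≤ D.m then D.cost C i t +
      F (g - D.point (j + 1) i t) (d - D.point j i t) else D.inf) k)
    (fun k s' v hI => by simpa using hI) (by simp [runMin, hs.inf])
    (p := .cond (.var 1 + .lit 1 - .var 23)
    (.assign 22 (minE (.var 22) (block 1 (.var 1 + .lit 1 + .var 23) +
      .get 7 (.get 6 (.var 20 - minE (.lit 1) (.var 18 - (.get 3 (.var 15) - .var 23))) +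
        (.var 21 - minE (.lit 1) (.var 17 - (.get 3 (.var 15) - .var 23))))))) .skip) ?_
  · rw [show (s.setReg 22 (s.reg 6)).reg 0 = D.len from hs.len] at this
    exact this
  intro t s' ht hf ht' hI
  have hs' : D.Ready s' := (hs.setReg (by norm_num)).of_frame hf rfl
  have hT' : D.Table F s' := Data.Table.of_frame (s := s.setReg 22 (s.reg 6)) hT hf rfl
  have r15 : s'.reg 15 = i := by rw [hf.reg 15 rfl]; simpa using h15
  have r17 := (hf.reg 17 rfl).trans h17
  have r18 := (hf.reg 18 rfl).trans h18
  have r20 := (hf.reg 20 rfl).trans h20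
  have r21 := (hf.reg 21 rfl).trans h21
  have rC : s'.arr 1 = C := (hf.arr 1 rfl).trans hC
  simp only [run, Expr.eval, eval_sub, eval_minE, eval_block, r15, r17, r18, r20, r21,
    rC, hs'.m, ht', runMin, hI, hs'.pp i hi, hs'.base i hi]
  -- Truncated subtraction keeps both indices inside the table.
  have hg' : g - D.point (j + 1) i t < D.len := by omega
  have hd' : d - D.point j i t < D.len := by omega
  have := hT' _ hg' _ hd'
  have hrow := hs'.row _ hg'
  unfold Data.point at this hrow
  by_cases htm : t ≤ D.m
  · rw [if_pos (by omega), if_pos htm]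
    simp only [State.setReg_reg, if_true, hrow, this, Data.cost, Data.point]
  -- Beyond `D.m` the minimum is taken with `D.inf`, which is harmless because the running minimum
  -- starts there.
  · rw [if_neg (by omega), if_neg htm, hI]
    exact (min_eq_left (runMin_le_base _ _ _)).symm

theorem levelProg_spec {s : State} {i j : ℕ} (hs : D.Ready s) (hi : i < D.len)
    (h15 : s.reg 15 = i) (h10 : s.reg 10 = j) :
    (levelProg.run s).reg 17 = min j (D.app i) ∧
    (levelProg.run s).reg 18 = min (j + 1) (D.app i) ∧
    (levelProg.run s).reg 19 = D.group j i := by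
  have happ := hs.app i hi
  have hord := hs.ord i hi (min j (D.app i) - 1)
  have hbase := hs.base i hi
  unfold Data.group
  by_cases h₁ : min j (D.app i) = 0
  · simp [levelProg, run, Expr.eval, h10, h15, hs.p, hs.m, hbase, happ, h₁]
  · by_cases h₂ : min j (D.app i) ≤ D.pp i
    · have h₃ : D.pp i + 1 - min j (D.app i) ≠ 0 := by omega
      simp [levelProg, run, Expr.eval, h10, h15, hs.p, hs.m, hbase, happ, h₁, h₂, h₃, hord,
        hs.pp i hi]
    · have h₃ : D.pp i + 1 - min j (D.app i) = 0 := by omega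
      simp [levelProg, run, Expr.eval, h10, h15, hs.p, hs.m, hbase, happ, h₁, h₂, h₃,
        hs.pp i hi]

theorem voterProg_spec {s : State} {F : ℕ → ℕ → ℕ} {C : ℕ → ℕ} {i j c : ℕ} (hs : D.Ready s)
    (hT : D.Table F s) (hC : s.arr 1 = C) (hi : i < D.len)
    (h15 : s.reg 15 = i) (h10 : s.reg 10 = j) (h13 : s.reg 13 = c) :
    D.Table (if i < D.n ∧ D.group j i = c then D.voterStep C j i F else F)
      (voterProg.run s) := by
  by_cases hin : i < D.n
  swap
  · have h₁ : ((Expr.var 2 - Expr.var 15).eval s) = 0 := by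
      simp only [eval_sub, Expr.eval, h15, hs.n]; omega
    simpa [voterProg, run, h₁, hin] using hT
  have h₁ : ((Expr.var 2 - Expr.var 15).eval s) ≠ 0 := by
    simp only [eval_sub, Expr.eval, h15, hs.n]; omega
  rw [voterProg, run, if_pos h₁, run]
  obtain ⟨h17, h18, h19⟩ := levelProg_spec hs hi h15 h10
  have hf := frame_run levelProg s
  have hs' := hs.of_frame hf rfl
  have hT' := hT.of_frame hf rfl
  have r13 := (hf.reg 13 rfl).trans h13
  have r15 := (hf.reg 15 rfl).trans h15
  have rC := (hf.arr 1 rfl).trans hC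
  generalize levelProg.run s = s' at *
  by_cases hg : D.group j i = c
  swap
  -- With truncated subtraction `(a - b) + (b - a)` vanishes exactly when `a = b`; this serves as
  -- the test for equality.
  · have h₂ : (((Expr.var 19 - .var 13) + (.var 13 - .var 19) : Expr).eval s') ≠ 0 := by
      simp only [eval_sub, Expr.eval, r13, h19]; omega
    rw [run, if_pos h₂]
    simpa [hg, run] using hT'
  have h₂ : (((Expr.var 19 - .var 13) + (.var 13 - .var 19) : Expr).eval s') = 0 := by
    simp only [eval_sub, Expr.eval, r13, h19]; omega
  rw [run, if_neg (not_not.2 h₂), if_pos ⟨hin, hg⟩]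
  refine tabulate_spec hs' rfl rfl rfl rfl fun s'' g d hg hd hf' h20 h21 => ?_
  exact voterBody_spec (hs'.of_frame hf' rfl) (hT'.of_frame hf' rfl) ((hf'.arr 1 rfl).trans rC)
    hi hg hd ((hf'.reg 15 rfl).trans r15) ((hf'.reg 17 rfl).trans h17)
    ((hf'.reg 18 rfl).trans h18) h20 h21

theorem closeBody_spec {s : State} {F : ℕ → ℕ → ℕ} {e g d : ℕ} (hs : D.Ready s)
    (hT : D.Table F s) (hg : g < D.len) (he : e < D.len)
    (h14 : s.reg 14 = e) (h20 : s.reg 20 = g) (h21 : s.reg 21 = d) :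
    (closeBody.run s).reg 22 = D.close e F g d := by
  have := hT g hg e he
  by_cases hd : d = 0
  · simpa [closeBody, run, Expr.eval, h20, h21, hd, h14, hs.row g hg, Data.close] using this
  · simp [closeBody, run, Expr.eval, h21, hd, Data.close, hs.inf]

theorem startBody_spec {s : State} {g d : ℕ} (hs : D.Ready s)
    (h20 : s.reg 20 = g) (h21 : s.reg 21 = d) :
    (startBody.run s).reg 22 = if g + d = 0 then 0 else D.inf := by
  by_cases hd : g + d = 0
  · simp [startBody, run, Expr.eval, h20, h21, hd]
  · simp only [startBody, run, Expr.eval, State.setReg_reg]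
    simp [h20, h21, hs.inf, -Nat.add_eq_zero_iff, hd]

theorem targetProg_spec {s : State} {j : ℕ} (hs : D.Ready s) (h10 : s.reg 10 = j) :
    (targetProg.run s).reg 11 = D.target j ∧ (targetProg.run s).reg 12 = D.cap j := by
  simp only [targetProg, run, Expr.eval, eval_sub, State.setReg_reg, h10, hs.m, hs.half]
  unfold Data.target Data.cap
  by_cases h₁ : j < D.m
  · have : D.m - j ≠ 0 := by omega
    simp [h₁, this]
  · have : D.m - j = 0 := by omega
    by_cases h₂ : j - D.m ≤ D.half
    · have h₃ : D.half + 1 - (j - D.m) ≠ 0 := by omega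
      simp [h₁, h₂, this, h₃]
    · have h₃ : D.half + 1 - (j - D.m) = 0 := by omega
      simp [h₁, h₂, this, h₃]

theorem needProg_spec {s : State} {j y c : ℕ} (hs : D.Ready s) (h10 : s.reg 10 = j)
    (h12 : s.reg 12 = y) (h13 : s.reg 13 = c) :
    (needProg.run s).reg 14 = D.need j y c := by
  have key := loop_induct (x := 15) (s := s.setReg 14 0)
    (p := .cond (.var 2 - .var 15) (.seq (.assign 17 (minE (.var 10) (block 0 (.var 1)))) <|
      .loop 16 <| .cond (.var 17 - .var 16)
        (.cond ((block 0 (.var 16) - .var 13) + (.var 13 - block 0 (.var 16))) .skip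
          (.assign 14 (.var 14 + .lit 1))) .skip) .skip)
    (fun k s' => s'.reg 14 = ∑ i ∈ Finset.range k, if i < D.n then
      ∑ x ∈ Finset.range D.len, if x < min j (D.app i) ∧ D.ord i x = c then 1 else 0 else 0)
    (fun k s' v hI => by simpa using hI) (by simp) ?_
  · rw [show (s.setReg 14 0).reg 0 = D.len from hs.len] at key
    rw [needProg, run, run, run, run, run]
    rw [show (Expr.lit 0).eval s = 0 from rfl]
    have hf := frame_run (.loop 15 (.cond (.var 2 - .var 15)
      (.seq (.assign 17 (minE (.var 10) (block 0 (.var 1)))) <|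
      .loop 16 <| .cond (.var 17 - .var 16)
        (.cond ((block 0 (.var 16) - .var 13) + (.var 13 - block 0 (.var 16))) .skip
          (.assign 14 (.var 14 + .lit 1))) .skip) .skip)) (s.setReg 14 0)
    have r3 := ((hf.reg 3 rfl).trans (show _ = s.reg 3 from rfl)).trans hs.p
    have r12 := ((hf.reg 12 rfl).trans (show _ = s.reg 12 from rfl)).trans h12
    have r13 := ((hf.reg 13 rfl).trans (show _ = s.reg 13 from rfl)).trans h13
    generalize Prog.run _ (s.setReg 14 0) = s' at *
    simp only [run, eval_sub, Expr.eval, State.setReg_reg, key, r12, r13, r3]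
    rw [Data.need, Data.score]
    generalize (∑ i ∈ Finset.range D.len, _ : ℕ) = v
    by_cases hcp : c = D.p
    · simp [hcp]
    · have : ¬(c - D.p = 0 ∧ D.p - c = 0) := by omega
      simp [hcp, this]
  intro i s' hi hf h15 hI
  rw [show (s.setReg 14 0).reg 0 = D.len from hs.len] at hi
  have hs' : D.Ready s' := (hs.setReg (by norm_num)).of_frame hf rfl
  have r10 : s'.reg 10 = j := (hf.reg 10 rfl).trans h10
  have r13 : s'.reg 13 = c := (hf.reg 13 rfl).trans h13
  rw [Finset.sum_range_succ]
  by_cases hin : i < D.n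
  swap
  · have h₁ : ((Expr.var 2 - Expr.var 15).eval s') = 0 := by
      simp only [eval_sub, Expr.eval, h15, hs'.n]; omega
    simpa [run, h₁, hin] using hI
  have h₁ : ((Expr.var 2 - Expr.var 15).eval s') ≠ 0 := by
    simp only [eval_sub, Expr.eval, h15, hs'.n]; omega
  rw [run, if_pos h₁, run, if_pos hin]
  have hv : (minE (.var 10) (block 0 (.var 1))).eval s' = min j (D.app i) := by
    simp only [eval_minE, eval_block, Expr.eval, r10, h15, hs'.m, hs'.base i hi, hs'.app i hi]
  have key := loop_induct (x := 16) (s := s'.setReg 17 (min j (D.app i)))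
    (p := .cond (.var 17 - .var 16)
        (.cond ((block 0 (.var 16) - .var 13) + (.var 13 - block 0 (.var 16))) .skip
          (.assign 14 (.var 14 + .lit 1))) .skip)
    (fun k s'' => s''.reg 14 = s'.reg 14 + ∑ x ∈ Finset.range k,
      if x < min j (D.app i) ∧ D.ord i x = c then 1 else 0)
    (fun k s' v hI => by simpa using hI) (by simp) ?_
  · rw [show (s'.setReg 17 (min j (D.app i))).reg 0 = D.len from hs'.len, hI] at key
    rw [run, hv]
    exact key
  intro x s'' hx hf' h16 hI'
  have hs'' : D.Ready s'' := (hs'.setReg (by norm_num)).of_frame hf' rfl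
  have r13' : s''.reg 13 = c := (hf'.reg 13 rfl).trans r13
  have r15' : s''.reg 15 = i := (hf'.reg 15 rfl).trans h15
  have r17' : s''.reg 17 = min j (D.app i) := (hf'.reg 17 rfl).trans (by simp)
  rw [Finset.sum_range_succ]
  simp only [run, eval_sub, Expr.eval, eval_block, r13', r15', r17', h16,
    hs''.base i hi, hs''.ord i hi]
  by_cases h₂ : x < min j (D.app i)
  · rw [if_pos (by omega)]
    by_cases h₃ : D.ord i x = c
    · rw [if_neg (by omega), if_pos ⟨h₂, h₃⟩]
      simp [hI', add_assoc]
    · rw [if_pos (by omega), if_neg (fun h => h₃ h.2), hI', add_zero]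
  · rw [if_neg (by omega), if_neg (fun h => h₂ h.1), hI', add_zero]

theorem groupProg_spec {s : State} {F : ℕ → ℕ → ℕ} {C : ℕ → ℕ} {j c : ℕ} (hs : D.Ready s)
    (hT : D.Table F s) (hC : s.arr 1 = C) (h10 : s.reg 10 = j) (h12 : s.reg 12 = D.cap j)
    (h13 : s.reg 13 = c) (hneed : c < D.m → D.need j (D.cap j) c < D.len) :
    D.Table (if c < D.m then D.close (D.need j (D.cap j) c) (D.voters C j c F D.len) else F)
      (groupProg.run s) := by
  by_cases hc : c < D.m
  swap
  · have h₁ : ((Expr.var 1 - Expr.var 13).eval s) = 0 := by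
      simp only [eval_sub, Expr.eval, h13, hs.m]; omega
    simpa [groupProg, run, h₁, hc] using hT
  have h₁ : ((Expr.var 1 - Expr.var 13).eval s) ≠ 0 := by
    simp only [eval_sub, Expr.eval, h13, hs.m]; omega
  rw [groupProg, run, if_pos h₁, if_pos hc, run, run]
  have h14 := needProg_spec hs h10 h12 h13
  have hf := frame_run needProg s
  have hs' := hs.of_frame hf rfl
  have hT' := hT.of_frame hf rfl
  have r10 := (hf.reg 10 rfl).trans h10
  have r13 := (hf.reg 13 rfl).trans h13
  have rC := (hf.arr 1 rfl).trans hC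
  generalize needProg.run s = s' at *
  have key := loop_induct (x := 15) (s := s') (p := voterProg)
    (fun k s'' => D.Table (D.voters C j c F k) s'') (fun k s' v hI => hI) hT' ?_
  · rw [hs'.len] at key
    have hf' := frame_run (.loop 15 voterProg) s'
    have hs'' := hs'.of_frame hf' rfl
    have r14 := (hf'.reg 14 rfl).trans h14
    generalize Prog.run _ s' = s'' at *
    refine tabulate_spec hs'' rfl rfl rfl rfl fun t g d hg hd hf' h20 h21 => ?_
    exact closeBody_spec (hs''.of_frame hf' rfl) (key.of_frame hf' rfl) hg (hneed hc)
      ((hf'.reg 14 rfl).trans r14) h20 h21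
  intro i s'' hi hf' h15 hI
  rw [hs'.len] at hi
  exact voterProg_spec (hs'.of_frame hf' rfl) hI ((hf'.arr 1 rfl).trans rC) hi h15
    ((hf'.reg 10 rfl).trans r10) ((hf'.reg 13 rfl).trans r13)

/-- The demands and targets are used as columns and rows of the table; `hneed` and `htarget` keep
them in its range. -/
theorem valueProg_spec {s : State} {C : ℕ → ℕ} (hs : D.Ready s) (hC : s.arr 1 = C)
    (hneed : ∀ j, ∀ c < D.m, D.need j (D.cap j) c < D.len) (htarget : ∀ j, D.target j < D.len) :
    (valueProg.run s).reg 26 = D.value C := by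
  have key := loop_induct (x := 10) (s := s.setReg 26 (s.reg 6))
    (p := .seq targetProg <| .seq (tabulate startBody) <| .seq (.loop 13 groupProg) <|
      .assign 26 (minE (.var 26) (.get 7 (.get 6 (.var 11)))))
    (fun k s' => s'.reg 26 = runMin D.inf (fun j => D.groups C j D.len (D.target j) 0) k)
    (fun k s' v hI => by simpa using hI) (by simp [runMin, hs.inf]) ?_
  · rw [show (s.setReg 26 (s.reg 6)).reg 0 = D.len from hs.len] at key
    exact key
  intro j s₁ hj hf₁ h10 hI
  have hs₁ : D.Ready s₁ := (hs.setReg (by norm_num)).of_frame hf₁ rfl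
  have hC₁ : s₁.arr 1 = C := (hf₁.arr 1 rfl).trans hC
  rw [run, run, run, run]
  obtain ⟨h11, h12⟩ := targetProg_spec hs₁ h10
  have hf₂ := frame_run targetProg s₁
  have hs₂ := hs₁.of_frame hf₂ rfl
  have hC₂ := (hf₂.arr 1 rfl).trans hC₁
  have h10₂ := (hf₂.reg 10 rfl).trans h10
  have h26₂ := (hf₂.reg 26 rfl).trans hI
  generalize targetProg.run s₁ = s₂ at *
  have hT : D.Table (D.groups C j 0) ((tabulate startBody).run s₂) :=
    tabulate_spec hs₂ rfl rfl rfl rfl fun t g d hg hd hf' h20 h21 =>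
      startBody_spec (hs₂.of_frame hf' rfl) h20 h21
  have hf₃ := frame_run (tabulate startBody) s₂
  have hs₃ := hs₂.of_frame hf₃ rfl
  have hC₃ := (hf₃.arr 1 rfl).trans hC₂
  have h10₃ := (hf₃.reg 10 rfl).trans h10₂
  have h11₃ := (hf₃.reg 11 rfl).trans h11
  have h12₃ := (hf₃.reg 12 rfl).trans h12
  have h26₃ := (hf₃.reg 26 rfl).trans h26₂
  generalize (tabulate startBody).run s₂ = s₃ at *
  have key := loop_induct (x := 13) (s := s₃) (p := groupProg)
    (fun k t => D.Table (D.groups C j k) t) (fun k s' v hI => hI) hT ?_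
  · rw [hs₃.len] at key
    have hf₄ := frame_run (.loop 13 groupProg) s₃
    have hs₄ := hs₃.of_frame hf₄ rfl
    have h11₄ := (hf₄.reg 11 rfl).trans h11₃
    have h26₄ := (hf₄.reg 26 rfl).trans h26₃
    generalize Prog.run _ s₃ = s₄ at *
    have h := key _ (htarget j) 0 ((Nat.zero_le _).trans_lt (htarget j))
    simp only [eval_minE, Expr.eval, State.setReg_reg, if_true, h11₄, h26₄,
      hs₄.row _ (htarget j), runMin]
    rw [← h, add_zero]
  intro c t hc hf h13 hI'
  rw [hs₃.len] at hc
  exact groupProg_spec (hs₃.of_frame hf rfl) hI' ((hf.arr 1 rfl).trans hC₃)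
    ((hf.reg 10 rfl).trans h10₃) ((hf.reg 12 rfl).trans h12₃) h13 (hneed j c)

/-! ## The main program -/

/-- The greatest number below `k` with the property `P`, or `0` if there is none. -/
def lastIndex (P : ℕ → Prop) [DecidablePred P] : ℕ → ℕ
  | 0 => 0
  | k + 1 => if P k then k else lastIndex P k

theorem lastIndex_eq {P : ℕ → Prop} [DecidablePred P] {k x : ℕ} (hx : P x) (hk : x < k)
    (hle : ∀ y, P y → y ≤ x) : lastIndex P k = x := by
  induction k with
  | zero => omega
  | succ k ih =>
    rw [lastIndex]
    split
    · have := hle k ‹_›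
      omega
    · refine ih (lt_of_le_of_ne (Nat.lt_succ_iff.1 hk) ?_)
      rintro rfl
      contradiction

/-- The number that stands for the cost `∞` when the input is `w`: it exceeds the total of any finite
costs. -/
def top (w : List ℕ) : ℕ := 1 + w.length * w.sum

/-- The cost that is represented by `x` in the input `w`. -/
def price (w : List ℕ) (x : ℕ) : ℕ := if x = 0 then top w else x - 1

/-- The data that are read off from the input `w`. -/
def dataOf (w : List ℕ) : Data where
  len := w.length
  m := w.getD 0 0
  n := w.getD 1 0
  p := w.getD 2 0
  half := lastIndex (fun i => i + i ≤ w.getD 1 0) w.length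
  inf := 1 + w.length * top w
  base i := 3 + i * (2 * w.getD 0 0 + 2)
  ord i x := w.getD (3 + i * (2 * w.getD 0 0 + 2) + x) 0
  app i := w.getD (3 + i * (2 * w.getD 0 0 + 2) + w.getD 0 0) 0
  pp i := lastIndex (fun x => x < w.getD 0 0 ∧
    w.getD (3 + i * (2 * w.getD 0 0 + 2) + x) 0 = w.getD 2 0) w.length

/-- Reads the numbers of candidates and voters and the designated candidate. -/
def headProg : Prog :=
  .seq (.assign 1 (.get 0 (.lit 0))) <| .seq (.assign 2 (.get 0 (.lit 1))) <|
    .assign 3 (.get 0 (.lit 2))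

/-- Computes half the number of voters. -/
def halfProg : Prog :=
  .loop 15 <| .cond (.var 2 + .lit 1 - (.var 15 + .var 15)) (.assign 4 (.var 15)) .skip

/-- Computes the sum of the input in register `8`. -/
def sumProg : Prog :=
  .loop 15 <| .assign 8 (.var 8 + .get 0 (.var 15))

/-- Puts one plus the product of the length of the input and the content of register `y` into
register `x`. -/
def scaleProg (x y : ℕ) : Prog :=
  .seq (.assign x (.lit 1)) <| .loop 15 <| .assign x (.var x + .var y)

/-- Fills array `1` with the costs that are represented by the numbers in the input. -/
def priceProg : Prog :=
  .loop 15 <| .cond (.get 0 (.var 15)) (.store 1 (.var 15) (.get 0 (.var 15) - .lit 1))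
    (.store 1 (.var 15) (.var 7))

/-- Fills array `a` with the numbers of an arithmetic progression. -/
def progressionProg (a : ℕ) (start step : Expr) : Prog :=
  .seq (.assign 8 start) <|
    .loop 15 <| .seq (.store a (.var 15) (.var 8)) (.assign 8 (.var 8 + step))

/-- Computes the positions of the designated candidate. -/
def positionProg : Prog :=
  .loop 15 <| .loop 16 <| .cond (.var 1 - .var 16)
    (.cond ((block 0 (.var 16) - .var 3) + (.var 3 - block 0 (.var 16))) .skip
      (.store 3 (.var 15) (.var 16))) .skip

/-- Prepares the memory. -/
def setupProg : Prog :=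
  .seq headProg <| .seq halfProg <| .seq sumProg <| .seq (scaleProg 7 8) <|
  .seq (scaleProg 6 7) <| .seq priceProg <|
  .seq (progressionProg 2 (.lit 3) (.var 1 + .var 1 + .lit 2)) <|
  .seq (progressionProg 6 (.lit 0) (.var 0)) positionProg

/-- Raises every cost that can be raised to `D.inf` without loss. -/
def searchProg : Prog :=
  .seq valueProg <| .seq (.assign 27 (.var 26)) <|
  .loop 28 <| .seq (.assign 29 (.get 1 (.var 28))) <| .seq (.store 1 (.var 28) (.var 6)) <|
    .seq valueProg <| .cond (.var 26 - .var 27) (.store 1 (.var 28) (.var 29)) .skip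

/-- Writes the shifts whose costs have not been raised. -/
def outputProg : Prog :=
  .loop 15 <| .cond (.var 2 - .var 15)
    (.loop 23 <| .cond (.var 1 + .lit 1 - .var 23)
      (.cond (.var 6 - block 1 (.var 1 + .lit 1 + .var 23)) (.emit (.var 23)) .skip) .skip) .skip

/-- The program that solves shift bribery. -/
def mainProg : Prog := .seq setupProg <| .seq searchProg outputProg

/-! ### Preparation of the memory. -/

theorem halfProg_spec (s : State) (h4 : s.reg 4 = 0) :
    (halfProg.run s).reg 4 = lastIndex (fun i => i + i ≤ s.reg 2) (s.reg 0) := by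
  refine loop_induct (fun k s' => s'.reg 4 = lastIndex (fun i => i + i ≤ s.reg 2) k)
    (fun k s' v hI => by simpa using hI) h4 ?_
  intro k s' hk hf h15 hI
  have r2 := hf.reg 2 rfl
  simp only [run, eval_sub, Expr.eval, h15, r2, lastIndex]
  by_cases h : k + k ≤ s.reg 2
  · rw [if_pos (by omega), if_pos h]; simp
  · rw [if_neg (by omega), if_neg h, hI]

theorem sumProg_spec (s : State) (h8 : s.reg 8 = 0) :
    (sumProg.run s).reg 8 = ∑ i ∈ Finset.range (s.reg 0), s.arr 0 i := by
  refine loop_induct (fun k s' => s'.reg 8 = ∑ i ∈ Finset.range k, s.arr 0 i)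
    (fun k s' v hI => by simpa using hI) h8 ?_
  intro k s' hk hf h15 hI
  simp [run, Expr.eval, h15, hf.arr 0 rfl, hI, Finset.sum_range_succ]

theorem scaleProg_spec (s : State) {x y : ℕ} (hx : x ≠ 15) (hx0 : x ≠ 0) (hxy : x ≠ y)
    (hy : y ≠ 15) : ((scaleProg x y).run s).reg x = 1 + s.reg 0 * s.reg y := by
  have := loop_induct (x := 15) (p := .assign x (.var x + .var y)) (s := s.setReg x 1)
    (fun k s' => s'.reg x = 1 + k * s.reg y)
    (fun k s' v hI => by simpa [hx] using hI) (by simp) ?_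
  · rw [State.setReg_reg, if_neg hx0.symm] at this
    exact this
  intro k s' hk hf h15 hI
  have ry : s'.reg y = s.reg y := by
    rw [hf.reg y (by simp [writesReg, hxy, hy.symm])]
    simp [hxy.symm]
  simp only [run, Expr.eval, State.setReg_reg, if_true, ry, hI]
  ring

theorem priceProg_spec (s : State) :
    ∀ i < s.reg 0, (priceProg.run s).arr 1 i =
      if s.arr 0 i = 0 then s.reg 7 else s.arr 0 i - 1 := by
  refine loop_induct (fun k s' => ∀ i < k, s'.arr 1 i =
      if s.arr 0 i = 0 then s.reg 7 else s.arr 0 i - 1)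
    (fun k s' v hI => by simpa using hI) (by simp) ?_
  intro k s' hk hf h15 hI i hi
  have r7 := hf.reg 7 rfl
  have a0 := hf.arr 0 rfl
  simp only [run, eval_sub, Expr.eval, h15, r7, a0]
  rcases Nat.lt_succ_iff_lt_or_eq.1 hi with h | rfl
  · split <;> simp [h.ne, hI i h]
  · by_cases h0 : s.arr 0 i = 0 <;> simp [h0]

theorem progressionProg_spec (s : State) {a b c : ℕ} {e₁ e₂ : Expr} (he₁ : e₁.eval s = b)
    (he₂ : ∀ s', Frame (progressionProg a e₁ e₂) s s' → e₂.eval s' = c) :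
    ∀ i < s.reg 0, ((progressionProg a e₁ e₂).run s).arr a i = b + i * c := by
  have := loop_induct (x := 15) (p := .seq (.store a (.var 15) (.var 8)) (.assign 8 (.var 8 + e₂)))
    (s := s.setReg 8 b) (fun k s' => s'.reg 8 = b + k * c ∧ ∀ i < k, s'.arr a i = b + i * c)
    (fun k s' v hI => by simpa using hI) (by simp) ?_
  · rw [progressionProg, run, run, he₁]
    exact this.2
  intro k s' hk hf h15 ⟨hI₁, hI₂⟩
  -- The increment is evaluated after the store of the same iteration, so `he₂` is needed for this
  -- intermediate memory.
  have hf' : Frame (progressionProg a e₁ e₂) s (s'.setArr a k (b + k * c)) := by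
    refine ⟨fun y hy => ?_, fun d hd => ?_, fun _ => ?_⟩
    · simp only [progressionProg, writesReg, Bool.or_eq_false_iff, beq_eq_false_iff_ne] at hy
      rw [State.setArr_reg, hf.reg y (by simp [writesReg, hy])]
      simp [hy.1.symm]
    · simp only [progressionProg, writesArr, Bool.or_eq_false_iff, beq_eq_false_iff_ne] at hd
      rw [State.setArr_arr_of_ne _ _ _ (by simpa [eq_comm] using hd), hf.arr d (by simp [writesArr, hd])]
      simp
    · exact hf.out rfl
  simp only [run, Expr.eval, h15, hI₁, he₂ _ hf']
  refine ⟨by simp [hI₁]; ring, fun i hi => ?_⟩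
  rcases Nat.lt_succ_iff_lt_or_eq.1 hi with h | rfl
  · simp [h.ne, hI₂ i h]
  · simp

theorem positionProg_spec (s : State) (h3 : ∀ i, s.arr 3 i = 0) :
    ∀ i < s.reg 0, (positionProg.run s).arr 3 i = lastIndex (fun x => x < s.reg 1 ∧
      s.arr 0 (s.arr 2 i + x) = s.reg 3) (s.reg 0) := by
  have := loop_induct (x := 15) (p := .loop 16 <| .cond (.var 1 - .var 16)
    (.cond ((block 0 (.var 16) - .var 3) + (.var 3 - block 0 (.var 16))) .skip
      (.store 3 (.var 15) (.var 16))) .skip) (s := s)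
    -- Cells not yet reached must still be `0`, the value of `lastIndex` on the empty range, with
    -- which the inner loop starts.
    (fun k s' => (∀ i < k, s'.arr 3 i = lastIndex (fun x => x < s.reg 1 ∧
      s.arr 0 (s.arr 2 i + x) = s.reg 3) (s.reg 0)) ∧ ∀ i, k ≤ i → s'.arr 3 i = 0)
    (fun k s' v hI => by simpa using hI) (by simp [h3]) ?_
  · exact this.1
  intro k s' hk hf h15 ⟨hI₁, hI₂⟩
  have := loop_induct (x := 16) (p := .cond (.var 1 - .var 16)
    (.cond ((block 0 (.var 16) - .var 3) + (.var 3 - block 0 (.var 16))) .skip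
      (.store 3 (.var 15) (.var 16))) .skip) (s := s')
    (fun l s'' => (∀ i, i ≠ k → s''.arr 3 i = s'.arr 3 i) ∧ s''.arr 3 k =
      lastIndex (fun x => x < s.reg 1 ∧ s.arr 0 (s.arr 2 k + x) = s.reg 3) l)
    (fun k s' v hI => by simpa using hI) (by simp [hI₂, lastIndex]) ?_
  · rw [hf.reg 0 rfl] at this
    refine ⟨fun i hi => ?_, fun i hi => ?_⟩
    · rcases Nat.lt_succ_iff_lt_or_eq.1 hi with h | rfl
      · rw [this.1 i h.ne, hI₁ i h]
      · exact this.2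
    · rw [this.1 i (by omega), hI₂ i (by omega)]
  intro l s'' hl hf' h16 ⟨hJ₁, hJ₂⟩
  have r15 := (hf'.reg 15 rfl).trans h15
  have r1 := (hf'.reg 1 rfl).trans (hf.reg 1 rfl)
  have r3 := (hf'.reg 3 rfl).trans (hf.reg 3 rfl)
  have a0 := (hf'.arr 0 rfl).trans (hf.arr 0 rfl)
  have a2 := (hf'.arr 2 rfl).trans (hf.arr 2 rfl)
  simp only [run, eval_sub, eval_block, Expr.eval, r15, h16, r1, r3, a0, a2, lastIndex]
  by_cases h : l < s.reg 1 ∧ s.arr 0 (s.arr 2 k + l) = s.reg 3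
  · rw [if_pos (by omega), if_neg (by omega), if_pos h]
    exact ⟨fun i hi => by simp [hi, hJ₁ i hi], by simp⟩
  · rw [if_neg h]
    by_cases h₁ : l < s.reg 1
    · rw [if_pos (by omega), if_pos (by omega)]
      exact ⟨hJ₁, hJ₂⟩
    · rw [if_neg (by omega)]
      exact ⟨hJ₁, hJ₂⟩

theorem setupProg_spec (w : List ℕ) :
    (dataOf w).Ready (setupProg.run (init w)) ∧
      (∀ i < w.length, (setupProg.run (init w)).arr 1 i = price w (w.getD i 0)) ∧
      (setupProg.run (init w)).out = [] := by
  have r0 : (init w).reg 0 = w.length := rfl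
  have a0 : ∀ i, (init w).arr 0 i = w.getD i 0 := fun i => rfl
  have hz : ∀ x, x ≠ 0 → (init w).reg x = 0 := fun x hx => if_neg hx
  have h3 : ∀ i, (init w).arr 3 i = 0 := fun i => rfl
  have out : (setupProg.run (init w)).out = [] := (frame_run setupProg (init w)).out rfl
  refine and_assoc.1 ⟨?_, out⟩
  have r4 := hz 4 (by norm_num)
  have r8 := hz 8 (by norm_num)
  clear out hz
  simp only [setupProg, run]
  -- After each subprogram its result is recorded, the known facts are transported through its
  -- frame, and the memory is made opaque again.
  generalize init w = s₀ at *
  have r1 : (headProg.run s₀).reg 1 = w.getD 0 0 := by simp [headProg, run, Expr.eval, a0]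
  have r2 : (headProg.run s₀).reg 2 = w.getD 1 0 := by simp [headProg, run, Expr.eval, a0]
  have r3 : (headProg.run s₀).reg 3 = w.getD 2 0 := by simp [headProg, run, Expr.eval, a0]
  have hf := frame_run headProg s₀
  rw [← hf.reg 0 rfl] at r0
  rw [← hf.reg 4 rfl] at r4
  rw [← hf.reg 8 rfl] at r8
  rw [← hf.arr 0 rfl] at a0
  rw [← hf.arr 3 rfl] at h3
  clear hf
  generalize headProg.run s₀ = s₁ at *
  replace r4 := halfProg_spec s₁ r4
  rw [r2, r0] at r4
  have hf := frame_run halfProg s₁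
  rw [← hf.reg 0 rfl] at r0
  rw [← hf.reg 1 rfl] at r1
  rw [← hf.reg 2 rfl] at r2
  rw [← hf.reg 3 rfl] at r3
  rw [← hf.reg 8 rfl] at r8
  rw [← hf.arr 0 rfl] at a0
  rw [← hf.arr 3 rfl] at h3
  clear hf
  generalize halfProg.run s₁ = s₂ at *
  replace r8 := sumProg_spec s₂ r8
  have hsum : ∑ i ∈ Finset.range (s₂.reg 0), s₂.arr 0 i = w.sum := by
    rw [r0, Finset.sum_congr rfl fun i _ => a0 i, Finset.sum_range, ← List.sum_ofFn]
    congr 1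
    exact List.ext_getElem (by simp) fun i h₁ h₂ => by simp
  rw [hsum] at r8
  have hf := frame_run sumProg s₂
  rw [← hf.reg 0 rfl] at r0
  rw [← hf.reg 1 rfl] at r1
  rw [← hf.reg 2 rfl] at r2
  rw [← hf.reg 3 rfl] at r3
  rw [← hf.reg 4 rfl] at r4
  rw [← hf.arr 0 rfl] at a0
  rw [← hf.arr 3 rfl] at h3
  clear hf hsum
  generalize sumProg.run s₂ = s₃ at *
  have r7 : ((scaleProg 7 8).run s₃).reg 7 = top w := by
    rw [scaleProg_spec s₃ (by norm_num) (by norm_num) (by norm_num) (by norm_num), r0, r8, top]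
  have hf := frame_run (scaleProg 7 8) s₃
  rw [← hf.reg 0 rfl] at r0
  rw [← hf.reg 1 rfl] at r1
  rw [← hf.reg 2 rfl] at r2
  rw [← hf.reg 3 rfl] at r3
  rw [← hf.reg 4 rfl] at r4
  rw [← hf.arr 0 rfl] at a0
  rw [← hf.arr 3 rfl] at h3
  clear hf r8
  generalize (scaleProg 7 8).run s₃ = s₄ at *
  have r6 : ((scaleProg 6 7).run s₄).reg 6 = 1 + w.length * top w := by
    rw [scaleProg_spec s₄ (by norm_num) (by norm_num) (by norm_num) (by norm_num), r0, r7]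
  have hf := frame_run (scaleProg 6 7) s₄
  rw [← hf.reg 0 rfl] at r0
  rw [← hf.reg 1 rfl] at r1
  rw [← hf.reg 2 rfl] at r2
  rw [← hf.reg 3 rfl] at r3
  rw [← hf.reg 4 rfl] at r4
  rw [← hf.reg 7 rfl] at r7
  rw [← hf.arr 0 rfl] at a0
  rw [← hf.arr 3 rfl] at h3
  clear hf
  generalize (scaleProg 6 7).run s₄ = s₅ at *
  have a1 : ∀ i < w.length, (priceProg.run s₅).arr 1 i = price w (w.getD i 0) := by
    intro i hi
    rw [priceProg_spec s₅ i (by rwa [r0]), r7, a0, price]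
  have hf := frame_run priceProg s₅
  rw [← hf.reg 0 rfl] at r0
  rw [← hf.reg 1 rfl] at r1
  rw [← hf.reg 2 rfl] at r2
  rw [← hf.reg 3 rfl] at r3
  rw [← hf.reg 4 rfl] at r4
  rw [← hf.reg 6 rfl] at r6
  rw [← hf.arr 0 rfl] at a0
  rw [← hf.arr 3 rfl] at h3
  clear hf r7
  generalize priceProg.run s₅ = s₆ at *
  have a2 := progressionProg_spec s₆ (a := 2) (b := 3) (c := 2 * w.getD 0 0 + 2) (e₁ := .lit 3)
    (e₂ := .var 1 + .var 1 + .lit 2) rfl fun s' hf => by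
      simp only [Expr.eval, hf.reg 1 rfl, r1]; ring
  rw [r0] at a2
  have hf := frame_run (progressionProg 2 (.lit 3) (.var 1 + .var 1 + .lit 2)) s₆
  rw [← hf.reg 0 rfl] at r0
  rw [← hf.reg 1 rfl] at r1
  rw [← hf.reg 2 rfl] at r2
  rw [← hf.reg 3 rfl] at r3
  rw [← hf.reg 4 rfl] at r4
  rw [← hf.reg 6 rfl] at r6
  rw [← hf.arr 0 rfl] at a0
  rw [← hf.arr 1 rfl] at a1
  rw [← hf.arr 3 rfl] at h3
  clear hf
  generalize (progressionProg 2 _ _).run s₆ = s₇ at *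
  have a6 := progressionProg_spec s₇ (a := 6) (b := 0) (c := w.length) (e₁ := .lit 0)
    (e₂ := .var 0) rfl fun s' hf => by simp only [Expr.eval, hf.reg 0 rfl, r0]
  rw [r0] at a6
  have hf := frame_run (progressionProg 6 (.lit 0) (.var 0)) s₇
  rw [← hf.reg 0 rfl] at r0
  rw [← hf.reg 1 rfl] at r1
  rw [← hf.reg 2 rfl] at r2
  rw [← hf.reg 3 rfl] at r3
  rw [← hf.reg 4 rfl] at r4
  rw [← hf.reg 6 rfl] at r6
  rw [← hf.arr 0 rfl] at a0
  rw [← hf.arr 1 rfl] at a1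
  rw [← hf.arr 2 rfl] at a2
  rw [← hf.arr 3 rfl] at h3
  clear hf
  generalize (progressionProg 6 _ _).run s₇ = s₈ at *
  have a3 := positionProg_spec s₈ h3
  rw [r0] at a3
  have hf := frame_run positionProg s₈
  refine ⟨⟨?_, ?_, ?_, ?_, ?_, ?_, ?_, ?_, ?_, ?_, ?_⟩, ?_⟩
  · rw [hf.reg 0 rfl, r0]; rfl
  · rw [hf.reg 1 rfl, r1]; rfl
  · rw [hf.reg 2 rfl, r2]; rfl
  · rw [hf.reg 3 rfl, r3]; rfl
  · rw [hf.reg 4 rfl, r4]; rfl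
  · rw [hf.reg 6 rfl, r6]; rfl
  · rw [hf.arr 2 rfl]; exact a2
  · rw [hf.arr 0 rfl]; exact fun i _ x => a0 _
  · rw [hf.arr 0 rfl]; exact fun i _ => a0 _
  · intro i hi
    rw [a3 i hi, r1, r3, a2 i hi]
    simp only [a0]
    rfl
  · rw [hf.arr 6 rfl]; exact fun g hg => (a6 g hg).trans (zero_add _)
  · rw [hf.arr 1 rfl]; exact a1

/-! ### The search that raises superfluous costs, and the output. -/

namespace Data

variable (D) in
/-- The costs after the search has gone through the addresses below `k`. -/
def search (C : ℕ → ℕ) (v : ℕ) : ℕ → ℕ → ℕ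
  | 0 => C
  | a + 1 => if D.value (Function.update (search C v a) a D.inf) ≤ v then
      Function.update (search C v a) a D.inf else search C v a

end Data

theorem searchProg_spec {s : State} {C : ℕ → ℕ} (hs : D.Ready s) (hC : s.arr 1 = C)
    (hneed : ∀ j, ∀ c < D.m, D.need j (D.cap j) c < D.len) (htarget : ∀ j, D.target j < D.len) :
    (searchProg.run s).arr 1 = D.search C (D.value C) D.len := by
  rw [searchProg, run, run]
  have h26 := valueProg_spec hs hC hneed htarget
  have hf := frame_run valueProg s
  have hs₁ := hs.of_frame hf rfl
  have hC₁ := (hf.arr 1 rfl).trans hC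
  generalize valueProg.run s = s₁ at *
  have key := loop_induct (x := 28) (s := s₁.setReg 27 (D.value C))
    (p := .seq (.assign 29 (.get 1 (.var 28))) <| .seq (.store 1 (.var 28) (.var 6)) <|
      .seq valueProg <| .cond (.var 26 - .var 27) (.store 1 (.var 28) (.var 29)) .skip)
    (fun k s' => s'.arr 1 = D.search C (D.value C) k) (fun k s' v hI => hI) hC₁ ?_
  · rw [show (s₁.setReg 27 (D.value C)).reg 0 = D.len from hs₁.len] at key
    rw [run, show (Expr.var 26).eval s₁ = D.value C from h26]
    exact key
  intro a s₂ ha hf₂ h28 hI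
  have hs₂ : D.Ready s₂ := (hs₁.setReg (by norm_num)).of_frame hf₂ rfl
  have h27 : s₂.reg 27 = D.value C := (hf₂.reg 27 rfl).trans (by simp)
  rw [Data.search]
  generalize D.search C (D.value C) a = C' at *
  have e29 : (Expr.get 1 (.var 28)).eval s₂ = C' a := by simp [Expr.eval, h28, hI]
  rw [run, run, run, run, run, e29]
  have e28 : (Expr.var 28).eval (s₂.setReg 29 (C' a)) = a := by simp [Expr.eval, h28]
  have e6 : (Expr.var 6).eval (s₂.setReg 29 (C' a)) = D.inf := by simp [Expr.eval, hs₂.inf]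
  rw [e28, e6]
  -- The single store is viewed as a program with literal operands so that the frame rule applies.
  have hs₃ : D.Ready ((s₂.setReg 29 (C' a)).setArr 1 a D.inf) :=
    (hs₂.setReg (x := 29) (v := C' a) (by norm_num)).of_frame
      (p := .store 1 (.lit a) (.lit D.inf)) (frame_run _ _) rfl
  have r27 : ((s₂.setReg 29 (C' a)).setArr 1 a D.inf).reg 27 = D.value C := by simp [h27]
  have r28 : ((s₂.setReg 29 (C' a)).setArr 1 a D.inf).reg 28 = a := by simp [h28]
  have r29 : ((s₂.setReg 29 (C' a)).setArr 1 a D.inf).reg 29 = C' a := by simp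
  have rC : ((s₂.setReg 29 (C' a)).setArr 1 a D.inf).arr 1 = Function.update C' a D.inf := by
    simp [State.setArr, hI]
  generalize (s₂.setReg 29 (C' a)).setArr 1 a D.inf = s₃ at *
  have h26 := valueProg_spec hs₃ rC hneed htarget
  have hf := frame_run valueProg s₃
  rw [← hf.reg 27 rfl] at r27
  rw [← hf.reg 28 rfl] at r28
  rw [← hf.reg 29 rfl] at r29
  rw [← hf.arr 1 rfl] at rC
  generalize valueProg.run s₃ = s₄ at *
  simp only [run, eval_sub, Expr.eval, h26, r27, r28, r29]
  by_cases h : D.value (Function.update C' a D.inf) ≤ D.value C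
  · rw [if_neg (by omega), if_pos h, rC]
  · rw [if_pos (by omega), if_neg h]
    simp [State.setArr, rC]

theorem outputProg_spec {s : State} {C : ℕ → ℕ} (hs : D.Ready s) (hC : s.arr 1 = C) :
    (outputProg.run s).out = s.out ++ (List.range D.len).flatMap fun i =>
      if i < D.n then (List.range D.len).filter fun t => t ≤ D.m ∧ D.cost C i t < D.inf
      else [] := by
  rw [← hs.len]
  refine loop_induct (fun k s' => s'.out = s.out ++ (List.range k).flatMap fun i =>
      if i < D.n then (List.range (s.reg 0)).filter fun t => t ≤ D.m ∧ D.cost C i t < D.inf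
      else []) (fun k s' v hI => by simpa using hI) (by simp) ?_
  intro i s' hi hf h15 hI
  rw [hs.len] at hi
  have hs' := hs.of_frame hf rfl
  have hC' := (hf.arr 1 rfl).trans hC
  simp only [List.range_succ, List.flatMap_append, List.flatMap_singleton]
  by_cases hin : i < D.n
  swap
  · have h₁ : ((Expr.var 2 - Expr.var 15).eval s') = 0 := by
      simp only [eval_sub, Expr.eval, h15, hs'.n]; omega
    simpa [run, h₁, hin] using hI
  have h₁ : ((Expr.var 2 - Expr.var 15).eval s') ≠ 0 := by
    simp only [eval_sub, Expr.eval, h15, hs'.n]; omega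
  rw [run, if_pos h₁, if_pos hin, ← List.append_assoc, ← hI, ← hf.reg 0 rfl]
  refine loop_induct (fun k s'' => s''.out = s'.out ++ (List.range k).filter fun t =>
    t ≤ D.m ∧ D.cost C i t < D.inf) (fun k s' v hI => by simpa using hI) (by simp) ?_
  intro t s'' ht hf' h23 hJ
  have hs'' := hs'.of_frame hf' rfl
  have r15 := (hf'.reg 15 rfl).trans h15
  have rC := (hf'.arr 1 rfl).trans hC'
  simp only [run, eval_sub, eval_block, Expr.eval, r15, h23, rC, hs''.m, hs''.inf, hs''.base i hi,
    List.range_succ, List.filter_append]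
  rw [← List.append_assoc, ← hJ,
    show C (D.base i + (D.m + 1 + t)) = D.cost C i t from rfl]
  by_cases h₁ : t ≤ D.m
  · rw [if_pos (by omega)]
    by_cases h₂ : D.cost C i t < D.inf
    · rw [if_pos (by omega)]
      simp [h₁, h₂]
    · rw [if_neg (by omega)]
      simp [h₂]
  · rw [if_neg (by omega)]
    simp [h₁]

/-- The cost array is known only at the addresses of the input, hence the existential quantifier
over `C`. -/
theorem mainProg_spec (w : List ℕ)
    (hneed : ∀ j, ∀ c < (dataOf w).m, (dataOf w).need j ((dataOf w).cap j) c < w.length)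
    (htarget : ∀ j, (dataOf w).target j < w.length) :
    ∃ C : ℕ → ℕ, (∀ i < w.length, C i = price w (w.getD i 0)) ∧
      (mainProg.run (init w)).out = (List.range w.length).flatMap fun i =>
        if i < (dataOf w).n then (List.range w.length).filter fun t => t ≤ (dataOf w).m ∧
          (dataOf w).cost ((dataOf w).search C ((dataOf w).value C) w.length) i t < (dataOf w).inf
        else [] := by
  obtain ⟨hs, hC, hout⟩ := setupProg_spec w
  refine ⟨_, hC, ?_⟩
  have hf := frame_run searchProg (setupProg.run (init w))
  have h₁ := searchProg_spec hs rfl hneed htarget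
  rw [mainProg, run, run, outputProg_spec (hs.of_frame hf rfl) h₁, hf.out rfl, hout]
  rfl

/-! ## Correctness of the dynamic program -/

theorem runMin_le {b k x : ℕ} {f : ℕ → ℕ} (hx : x < k) : runMin b f k ≤ f x := by
  induction k with
  | zero => omega
  | succ k ih =>
    rcases Nat.lt_succ_iff_lt_or_eq.1 hx with h | rfl
    · exact (min_le_left _ _).trans (ih h)
    · exact min_le_right _ _

theorem exists_of_runMin_lt {b k : ℕ} {f : ℕ → ℕ} (h : runMin b f k < b) :
    ∃ x < k, runMin b f k = f x := by
  induction k with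
  | zero => exact absurd h (lt_irrefl _)
  | succ k ih =>
    rcases le_total (runMin b f k) (f k) with hk | hk
    · rw [runMin, min_eq_left hk] at h ⊢
      obtain ⟨x, hx, hx'⟩ := ih h
      exact ⟨x, hx.trans (Nat.lt_succ_self k), hx'⟩
    · exact ⟨k, Nat.lt_succ_self k, min_eq_right hk⟩

namespace Data

variable (D : Data) (C : ℕ → ℕ) (j : ℕ)

/-- The shifts `t` make `D.p` a winner on account of the rounds `j` and `j + 1`. -/
structure Wins (t : ℕ → ℕ) : Prop where
  target_le : D.target j ≤ ∑ i ∈ Finset.range D.n, D.point (j + 1) i (t i)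
  need_le : ∀ c < D.m, D.need j (D.cap j) c ≤
    ∑ i ∈ Finset.range D.n with D.group j i = c, D.point j i (t i)

/-- `F g d` is the least cost of shifts of the voters in `S ∪ Q` that satisfy the demand `P`, give
`g` points to `D.p` and take `d` points away in `Q`. -/
structure IsTable (S Q : Finset ℕ) (P : (ℕ → ℕ) → Prop) (F : ℕ → ℕ → ℕ) : Prop where
  le : ∀ t : ℕ → ℕ, (∀ i, t i ≤ D.m) → P t → ∀ g d,
    g ≤ ∑ i ∈ S, D.point (j + 1) i (t i) + ∑ i ∈ Q, D.point (j + 1) i (t i) →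
    d ≤ ∑ i ∈ Q, D.point j i (t i) →
    F g d ≤ ∑ i ∈ S, D.cost C i (t i) + ∑ i ∈ Q, D.cost C i (t i)
  exists_eq : ∀ g d, F g d < D.inf → ∃ t : ℕ → ℕ, (∀ i, t i ≤ D.m) ∧ P t ∧
    g ≤ ∑ i ∈ S, D.point (j + 1) i (t i) + ∑ i ∈ Q, D.point (j + 1) i (t i) ∧
    d ≤ ∑ i ∈ Q, D.point j i (t i) ∧
    ∑ i ∈ S, D.cost C i (t i) + ∑ i ∈ Q, D.cost C i (t i) = F g d

variable {D C j}

/-- Once the shift of the new voter is chosen, the others have to supply what her points leave of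
`g` and `d`. Truncated subtraction matches the reading "at least", so a surplus of points needs no
extra entries. -/
theorem IsTable.voterStep {S Q : Finset ℕ} {P : (ℕ → ℕ) → Prop} {F : ℕ → ℕ → ℕ}
    (h : D.IsTable C j S Q P F) {i : ℕ} (hS : i ∉ S) (hQ : i ∉ Q)
    (hP : ∀ t v, P t → P (Function.update t i v)) (hm : D.m < D.len) :
    D.IsTable C j S (insert i Q) P (D.voterStep C j i F) := by
  constructor
  · intro t ht hPt g d hg hd
    rw [Finset.sum_insert hQ] at hg hd ⊢
    have h₁ := h.le t ht hPt (g - D.point (j + 1) i (t i)) (d - D.point j i (t i))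
      (by omega) (by omega)
    refine (runMin_le ((ht i).trans_lt hm)).trans ?_
    rw [if_pos (ht i)]
    omega
  · intro g d hlt
    obtain ⟨v, -, hv⟩ := exists_of_runMin_lt hlt
    -- The iterations beyond `D.m` contribute `D.inf`, so they cannot attain a smaller minimum.
    have hvm : v ≤ D.m := by
      by_contra hvm
      rw [if_neg hvm] at hv
      exact absurd hlt (by rw [Data.voterStep, hv]; exact lt_irrefl _)
    rw [if_pos hvm] at hv
    obtain ⟨t, ht, hPt, hg, hd, heq⟩ := h.exists_eq (g - D.point (j + 1) i v)
      (d - D.point j i v) (by rw [Data.voterStep, hv] at hlt; omega)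
    have sum_update : ∀ (T : Finset ℕ), i ∉ T → ∀ f : ℕ → ℕ → ℕ,
        ∑ k ∈ T, f k (Function.update t i v k) = ∑ k ∈ T, f k (t k) := by
      intro T hT f
      refine Finset.sum_congr rfl fun k hk => ?_
      rw [Function.update_of_ne]
      rintro rfl
      exact hT hk
    refine ⟨Function.update t i v, fun k => ?_, hP t v hPt, ?_, ?_, ?_⟩
    · rcases eq_or_ne k i with rfl | hk
      · simpa using hvm
      · simpa [hk] using ht k
    · rw [Finset.sum_insert hQ, sum_update S hS (D.point (j + 1)),
        sum_update Q hQ (D.point (j + 1)), Function.update_self]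
      omega
    · rw [Finset.sum_insert hQ, sum_update Q hQ (D.point j), Function.update_self]
      omega
    · rw [Finset.sum_insert hQ, sum_update S hS (D.cost C), sum_update Q hQ (D.cost C),
        Function.update_self, Data.voterStep, hv]
      omega

/-- Once the demand `e` of the group is met, its lost points are irrelevant: column `e` becomes
column `0`. The other columns are infeasible because the next group has no voters yet. -/
theorem IsTable.close {S Q T : Finset ℕ} {P P' : (ℕ → ℕ) → Prop} {F : ℕ → ℕ → ℕ} {e : ℕ}
    (h : D.IsTable C j S Q P F) (hSQ : Disjoint S Q) (hT : T = S ∪ Q)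
    (hP : ∀ t, P' t ↔ P t ∧ e ≤ ∑ i ∈ Q, D.point j i (t i)) :
    D.IsTable C j T ∅ P' (D.close e F) := by
  subst hT
  constructor
  · intro t ht hPt g d hg hd
    obtain ⟨hPt, he⟩ := (hP t).1 hPt
    rw [Finset.sum_empty] at *
    rw [Finset.sum_union hSQ, add_zero] at *
    rw [Data.close, if_pos (by omega)]
    exact h.le t ht hPt g e hg he
  · intro g d hlt
    rw [Data.close] at hlt ⊢
    split at hlt
    · rename_i hd
      rw [if_pos hd]
      obtain ⟨t, ht, hPt, hg, he, heq⟩ := h.exists_eq g e hlt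
      refine ⟨t, ht, (hP t).2 ⟨hPt, he⟩, ?_, ?_, ?_⟩
      · rwa [Finset.sum_empty, Finset.sum_union hSQ, add_zero]
      · omega
      · rwa [Finset.sum_empty, Finset.sum_union hSQ, add_zero]
    · exact absurd hlt (lt_irrefl _)

theorem isTable_voters {P : (ℕ → ℕ) → Prop} {F : ℕ → ℕ → ℕ} {c : ℕ}
    (h : D.IsTable C j {i ∈ Finset.range D.n | D.group j i < c} ∅ P F)
    (hP : ∀ i t v, D.group j i = c → P t → P (Function.update t i v)) (hm : D.m < D.len) (k : ℕ) :
    D.IsTable C j {i ∈ Finset.range D.n | D.group j i < c}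
      {i ∈ Finset.range D.n | i < k ∧ D.group j i = c} P (D.voters C j c F k) := by
  induction k with
  | zero => simpa [voters] using h
  | succ k ih =>
    rw [voters]
    split
    · rename_i hk
      convert ih.voterStep (i := k) ?_ ?_ (fun t v => hP k t v hk.2) hm using 1
      · ext i
        simp only [Finset.mem_filter, Finset.mem_range, Finset.mem_insert]
        constructor
        · rintro ⟨h₁, h₂, h₃⟩
          rcases Nat.lt_succ_iff_lt_or_eq.1 h₂ with h | h
          · exact Or.inr ⟨h₁, h, h₃⟩
          · exact Or.inl h
        · rintro (rfl | ⟨h₁, h₂, h₃⟩)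
          · exact ⟨hk.1, Nat.lt_succ_self i, hk.2⟩
          · exact ⟨h₁, by omega, h₃⟩
      · simp [hk.2]
      · simp
    · rename_i hk
      convert ih using 1
      ext i
      simp only [Finset.mem_filter, Finset.mem_range]
      constructor
      · rintro ⟨h₁, h₂, h₃⟩
        refine ⟨h₁, lt_of_le_of_ne (Nat.lt_succ_iff.1 h₂) ?_, h₃⟩
        rintro rfl
        exact hk ⟨h₁, h₃⟩
      · rintro ⟨h₁, h₂, h₃⟩
        exact ⟨h₁, by omega, h₃⟩

/-- Each voter lies in exactly one group, so the demands bind disjoint sets of voters and are met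
group by group; only the count for `D.p` is passed on. -/
theorem isTable_groups (hm : D.m < D.len) (hn : D.n < D.len) {c : ℕ} (hc : c ≤ D.m) :
    D.IsTable C j {i ∈ Finset.range D.n | D.group j i < c} ∅
      (fun t => ∀ c' < c, D.need j (D.cap j) c' ≤
        ∑ i ∈ Finset.range D.n with D.group j i = c', D.point j i (t i)) (D.groups C j c) := by
  induction c with
  | zero =>
    constructor
    · intro t _ _ g d hg hd
      have : g + d = 0 := by simp at hg hd; omega
      simp [groups, this]
    · intro g d h
      have hgd : g + d = 0 := by
        by_contra hgd
        simp only [groups, if_neg hgd] at h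
        exact lt_irrefl _ h
      exact ⟨fun _ => 0, fun _ => Nat.zero_le _, by simp, by omega, by omega, by simp [groups, hgd]⟩
  | succ c ih =>
    have h := isTable_voters (ih (by omega)) (c := c) ?_ hm D.len
    · rw [groups, if_pos (by omega)]
      refine h.close ?_ ?_ fun t => ?_
      · rw [Finset.disjoint_left]
        intro i hi hi'
        simp only [Finset.mem_filter] at hi hi'
        omega
      · ext i
        simp only [Finset.mem_filter, Finset.mem_range, Finset.mem_union]
        omega
      · have : ({i ∈ Finset.range D.n | i < D.len ∧ D.group j i = c} : Finset ℕ) =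
            {i ∈ Finset.range D.n | D.group j i = c} := by
          ext i
          simp only [Finset.mem_filter, Finset.mem_range]
          omega
        rw [this]
        constructor
        · exact fun h => ⟨fun c' hc' => h c' (by omega), h c (Nat.lt_succ_self c)⟩
        · rintro ⟨h₁, h₂⟩ c' hc'
          rcases Nat.lt_succ_iff_lt_or_eq.1 hc' with h | rfl
          · exact h₁ c' h
          · exact h₂
    -- The demands of earlier candidates involve no voter of group `c`, so her shift is still free.
    · intro i t v hi h c' hc'
      refine (h c' hc').trans (le_of_eq (Finset.sum_congr rfl fun k hk => ?_))
      rw [Function.update_of_ne]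
      rintro rfl
      simp only [Finset.mem_filter] at hk
      omega

theorem groups_of_le {k : ℕ} (hk : D.m ≤ k) : D.groups C j k = D.groups C j D.m := by
  induction k, hk using Nat.le_induction with
  | base => rfl
  | succ k hk ih => rw [groups, if_neg (by omega), ih]

theorem isTable_groups_len (hm : D.m < D.len) (hn : D.n < D.len)
    (hgroup : ∀ i < D.n, D.group j i < D.m) :
    D.IsTable C j (Finset.range D.n) ∅
      (fun t => ∀ c < D.m, D.need j (D.cap j) c ≤
        ∑ i ∈ Finset.range D.n with D.group j i = c, D.point j i (t i)) (D.groups C j D.len) := by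
  rw [groups_of_le hm.le]
  convert isTable_groups hm hn le_rfl using 1
  ext i
  simpa using hgroup i

theorem value_le (hm : D.m < D.len) (hn : D.n < D.len)
    (hgroup : ∀ j, ∀ i < D.n, D.group j i < D.m) (hj : j < D.len) {t : ℕ → ℕ}
    (ht : ∀ i, t i ≤ D.m) (hw : D.Wins j t) :
    D.value C ≤ ∑ i ∈ Finset.range D.n, D.cost C i (t i) := by
  have h := (isTable_groups_len (C := C) hm hn (hgroup j)).le t ht hw.need_le (D.target j) 0
    (by simpa using hw.target_le) (by simp)
  rw [Finset.sum_empty, add_zero] at h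
  exact (runMin_le hj).trans h

theorem exists_of_value_lt (hm : D.m < D.len) (hn : D.n < D.len)
    (hgroup : ∀ j, ∀ i < D.n, D.group j i < D.m) (h : D.value C < D.inf) :
    ∃ j, ∃ t : ℕ → ℕ, (∀ i, t i ≤ D.m) ∧ D.Wins j t ∧
      ∑ i ∈ Finset.range D.n, D.cost C i (t i) = D.value C := by
  obtain ⟨j, -, hj⟩ := exists_of_runMin_lt h
  obtain ⟨t, ht, hneed, htarget, -, heq⟩ :=
    (isTable_groups_len (C := C) hm hn (hgroup j)).exists_eq (D.target j) 0 (hj ▸ h)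
  rw [Finset.sum_empty, add_zero] at htarget heq
  exact ⟨j, t, ht, ⟨htarget, hneed⟩, heq.trans hj.symm⟩

/-- An entry is only ever replaced by `D.inf`, which dominates all entries of the input range. -/
theorem le_search {v : ℕ} (hC : ∀ a < D.len, C a ≤ D.inf) {k l : ℕ} (hkl : k ≤ l)
    (hl : l ≤ D.len) (a : ℕ) : D.search C v k a ≤ D.search C v l a := by
  have le_inf : ∀ k, ∀ a < D.len, D.search C v k a ≤ D.inf := by
    intro k
    induction k with
    | zero => exact hC
    | succ k ih =>
      intro a ha
      rw [search]
      split
      · rw [Function.update_apply]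
        split
        · exact le_rfl
        · exact ih a ha
      · exact ih a ha
  induction l, hkl using Nat.le_induction with
  | base => exact le_rfl
  | succ l hkl ih =>
    refine (ih (by omega)).trans ?_
    rw [search]
    split
    · rw [Function.update_apply]
      split
      · rename_i ha
        exact ha ▸ le_inf l l (by omega)
      · exact le_rfl
    · exact le_rfl

/-- The entries that survive the search belong to optimal shifts `t`, where `A` is the set of the
shifts that the value refers to. -/
theorem search_spec {A : Set (ℕ → ℕ)}
    (hle : ∀ C, ∀ t ∈ A, D.value C ≤ ∑ i ∈ Finset.range D.n, D.cost C i (t i))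
    (hex : ∀ C, D.value C < D.inf →
      ∃ t ∈ A, ∑ i ∈ Finset.range D.n, D.cost C i (t i) = D.value C)
    (hA : ∀ t ∈ A, ∀ i, t i ≤ D.m) (hC : ∀ a < D.len, C a ≤ D.inf)
    (hlt : D.value C < D.inf)
    (haddr : ∀ i < D.n, ∀ x ≤ D.m, D.base i + (D.m + 1 + x) < D.len)
    (hinj : ∀ i i' x x', x ≤ D.m → x' ≤ D.m →
      D.base i + (D.m + 1 + x) = D.base i' + (D.m + 1 + x') → i = i' ∧ x = x') :
    ∃ t ∈ A, (∀ s ∈ A, ∑ i ∈ Finset.range D.n, D.cost C i (t i) ≤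
        ∑ i ∈ Finset.range D.n, D.cost C i (s i)) ∧
      ∀ i < D.n, ∀ x ≤ D.m,
        D.cost (D.search C (D.value C) D.len) i x < D.inf ↔ x = t i := by
  have hval : ∀ k, D.value (D.search C (D.value C) k) ≤ D.value C := by
    intro k
    induction k with
    | zero => exact le_rfl
    | succ k ih =>
      rw [search]
      split <;> assumption
  -- Take `t` optimal for the final costs. Costs only grew, so at every stage its total is at most
  -- the original optimum.
  obtain ⟨t, ht, heq⟩ := hex _ ((hval D.len).trans_lt hlt)
  have hsum : ∀ k ≤ D.len, ∑ i ∈ Finset.range D.n, D.cost (D.search C (D.value C) k) i (t i) ≤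
      D.value C := fun k hk =>
    (Finset.sum_le_sum fun i _ => le_search hC hk le_rfl _).trans (heq.le.trans (hval _))
  refine ⟨t, ht, fun s hs => (hsum 0 (Nat.zero_le _)).trans (hle C s hs), fun i hi x hx =>
    ⟨fun h => ?_, ?_⟩⟩
  · by_contra hne
    have ha := haddr i hi x hx
    set a := D.base i + (D.m + 1 + x) with hadef
    -- Since `x ≠ t i`, the shifts `t` do not use the address `a`. At stage `a` they therefore show
    -- that raising this entry is without loss, so it was raised.
    have hkeep : D.value (Function.update (D.search C (D.value C) a) a D.inf) ≤ D.value C := by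
      refine (hle _ t ht).trans (le_trans (le_of_eq ?_) (hsum a ha.le))
      refine Finset.sum_congr rfl fun i' hi' => Function.update_of_ne (fun h' => hne ?_) _ _
      obtain ⟨hi'', hx'⟩ := hinj _ _ _ _ (hA t ht i') hx h'
      rw [← hx', hi'']
    have h₁ := le_search (v := D.value C) hC (Nat.succ_le_of_lt ha) le_rfl a
    rw [Nat.succ_eq_add_one, search, if_pos hkeep, Function.update_self] at h₁
    exact absurd (h₁.trans_lt h) (lt_irrefl _)
  · rintro rfl
    exact ((Finset.single_le_sum (f := fun i => D.cost (D.search C (D.value C) D.len) i (t i))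
      (fun _ _ => Nat.zero_le _) (Finset.mem_range.2 hi)).trans (hsum _ le_rfl)).trans_lt hlt

end Data
end Voting.Bribery

namespace Voting

open Bribery

/-! ## The simplified Fallback rule -/

section Rule

variable {m n : ℕ} {E : Election m n}

theorem truncScore_mono {k l : ℕ} (h : k ≤ l) (c : Fin m) : truncScore E k c ≤ truncScore E l c :=
  Finset.card_le_card fun i hi => by
    simp only [Finset.mem_filter, Finset.mem_univ, true_and] at hi ⊢
    exact ⟨hi.1, hi.2.trans h⟩

theorem truncScore_of_le {k : ℕ} (h : m ≤ k) (c : Fin m) :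
    truncScore E k c = approvalScore E c := by
  unfold truncScore approvalScore
  congr 1
  ext i
  have : (E i).rank c ≤ m := by simp only [Voter.rank]; omega
  simp only [Finset.mem_filter, Finset.mem_univ, true_and]
  omega

theorem truncScore_zero (c : Fin m) : truncScore E 0 c = 0 := by
  simp [truncScore, Voter.rank]

theorem truncScore_le_approvalScore (k : ℕ) (c : Fin m) :
    truncScore E k c ≤ approvalScore E c := by
  rw [← truncScore_of_le (le_max_left m k)]
  exact truncScore_mono (le_max_right m k) c

theorem truncScore_eq_sum (k : ℕ) (c : Fin m) : truncScore E k c =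
    ∑ i, if ((E i).pos c : ℕ) < min k (E i).approvals then 1 else 0 := by
  rw [truncScore, Finset.card_filter]
  refine Finset.sum_congr rfl fun i _ => ?_
  congr 1
  simp only [Voter.rank, eq_iff_iff]
  omega

/-- Let `d` have a majority in the earliest possible round. If `d ≠ p`, this round cannot be at most
`j` by monotonicity of scores, so it is `j + 1`, where `p` has a majority as well. -/
theorem mem_simplifiedFallback_of_majority {p : Fin m} {j : ℕ}
    (hp : n / 2 + 1 ≤ truncScore E (j + 1) p) (hc : ∀ c ≠ p, truncScore E j c ≤ n / 2) :
    p ∈ simplifiedFallback m n E := by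
  classical
  have hex : ∃ k, ∃ d, HasMajority E k d := ⟨j + 1, p, hp⟩
  refine Or.inl ⟨Nat.find hex, ⟨Nat.find_spec hex, fun k hk => Nat.find_min' hex hk⟩, ?_⟩
  obtain ⟨d, hd⟩ := Nat.find_spec hex
  have hle : Nat.find hex ≤ j + 1 := Nat.find_min' hex ⟨p, hp⟩
  by_cases hdp : d = p
  · exact hdp ▸ hd
  · rcases Nat.lt_or_ge j (Nat.find hex) with h | h
    · rw [le_antisymm hle h]
      exact hp
    · have := (hd.trans (truncScore_mono h d)).trans (hc d hdp)
      omega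

/-- From round `m` on, scores are approval scores. With `y = j - D.m` at most `n / 2`, either `p`
has a majority and is the only one, or her approval score is maximal and nobody has a majority. For
larger `j` target and cap fall back to the majority values, so no upper bound on `j` is needed here.
-/
theorem mem_simplifiedFallback_of_target_le {D : Data} (hm : D.m = m) (hh : D.half = n / 2)
    {p : Fin m} {j : ℕ} (hp : D.target j ≤ truncScore E (j + 1) p)
    (hc : ∀ c ≠ p, truncScore E j c ≤ D.cap j) : p ∈ simplifiedFallback m n E := by
  by_cases h : D.m ≤ j ∧ j - D.m ≤ D.half
  · rw [Data.target, if_neg (by omega), if_pos h.2] at hp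
    simp only [Data.cap, if_neg (not_lt.2 h.1), if_pos h.2] at hc
    by_cases hmaj : n / 2 + 1 ≤ truncScore E (j + 1) p
    · exact mem_simplifiedFallback_of_majority hmaj fun c hcp => (hc c hcp).trans (by omega)
    · rw [truncScore_of_le (by omega)] at hp hmaj
      have ha : ∀ c, approvalScore E c ≤ approvalScore E p := fun c => by
        by_cases hcp : c = p
        · rw [hcp]
        · rw [← truncScore_of_le (k := j) (by omega)]
          exact (hc c hcp).trans hp
      refine Or.inr ⟨?_, ha⟩
      rintro ⟨k, d, hd⟩
      have := (hd.trans (truncScore_le_approvalScore k d)).trans (ha d)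
      omega
  · have ht : D.target j = n / 2 + 1 := by
      unfold Data.target
      split_ifs <;> omega
    have hcap : D.cap j = n / 2 := by
      unfold Data.cap
      split_ifs <;> omega
    exact mem_simplifiedFallback_of_majority (ht ▸ hp) fun c hcp => hcap ▸ hc c hcp

/-- A candidate wins if and only if, for some `j`, her score in round `j + 1` reaches the target and
the scores of the others in round `j` stay below the cap. -/
theorem mem_simplifiedFallback_iff {D : Data} (hm : D.m = m) (hh : D.half = n / 2) {p : Fin m} :
    p ∈ simplifiedFallback m n E ↔ ∃ j ≤ m + n / 2,
      D.target j ≤ truncScore E (j + 1) p ∧ ∀ c ≠ p, truncScore E j c ≤ D.cap j := by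
  constructor
  · rintro (⟨k, ⟨⟨d, hd⟩, hk⟩, hp⟩ | ⟨hno, hp⟩)
    -- Scores are constant from round `m` on and zero in round `0`, so the earliest majority round
    -- is `j + 1` with `j < m`.
    · have hkm : k ≤ m := by
        by_contra h
        have := hk ⟨d, show n / 2 + 1 ≤ truncScore E m d by
          rw [truncScore_of_le le_rfl, ← truncScore_of_le (by omega : m ≤ k)]; exact hd⟩
        omega
      have hk0 : k ≠ 0 := by
        rintro rfl
        simp [HasMajority, truncScore_zero] at hp
      obtain ⟨j, rfl⟩ := Nat.exists_eq_succ_of_ne_zero hk0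
      refine ⟨j, by omega, ?_, fun c _ => ?_⟩
      · rw [Data.target, if_pos (by omega), hh]
        exact hp
      · rw [Data.cap, if_pos (by omega), hh]
        by_contra h
        have := hk ⟨c, show n / 2 + 1 ≤ truncScore E j c by omega⟩
        omega
    · have hpa : approvalScore E p ≤ n / 2 := by
        by_contra h
        refine hno ⟨m, p, ?_⟩
        rw [HasMajority, truncScore_of_le le_rfl]
        omega
      -- The approval score of `p` serves as both target and cap; in the absence of a majority it is
      -- at most `n / 2`.
      refine ⟨m + approvalScore E p, by omega, ?_, fun c _ => ?_⟩
      · rw [Data.target, if_neg (by omega), if_pos (by omega), truncScore_of_le (by omega)]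
        omega
      · rw [Data.cap, if_neg (by omega), if_pos (by omega), truncScore_of_le (by omega)]
        exact (hp c).trans (by omega)
  · rintro ⟨j, -, hp, hc⟩
    exact mem_simplifiedFallback_of_target_le hm hh hp hc

end Rule

/-! ## Shifts -/

theorem Voter.shift_pos_self {m : ℕ} (v : Voter m) (p : Fin m) (t : ℕ) :
    ((v.shift p t).pos p : ℕ) = v.pos p - t := by
  have := p.pos
  have : NeZero m := ⟨by omega⟩
  simp only [Voter.shift, Equiv.trans_apply]
  rw [Fin.cycleIcc_of_last (Fin.mk_le_of_le_val (Nat.sub_le _ _))]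

theorem Voter.shift_pos_of_ne {m : ℕ} (v : Voter m) {p c : Fin m} (hc : c ≠ p) (t : ℕ) :
    ((v.shift p t).pos c : ℕ) =
      if (v.pos p : ℕ) - t ≤ v.pos c ∧ (v.pos c : ℕ) < v.pos p then (v.pos c : ℕ) + 1
      else v.pos c := by
  have hne : (v.pos c : ℕ) ≠ v.pos p := fun h => hc (v.pos.injective (Fin.ext h))
  have := p.pos
  have : NeZero m := ⟨by omega⟩
  simp only [Voter.shift, Equiv.trans_apply]
  split_ifs with h
  · rw [Fin.cycleIcc_of_ge_of_lt (Fin.mk_le_of_le_val h.1) h.2, Fin.val_add_one_of_lt' (by omega)]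
  · rw [not_and_or, not_le, not_lt] at h
    rcases h with h | h
    · rw [Fin.cycleIcc_of_lt (Fin.lt_def.2 h)]
    · rw [Fin.cycleIcc_of_gt (Fin.lt_def.2 (lt_of_le_of_ne h hne.symm))]

/-! ## The encoding -/

theorem flatten_getD {l : List (List ℕ)} {k : ℕ} (hl : ∀ b ∈ l, b.length = k) {i x : ℕ}
    (hi : i < l.length) (hx : x < k) : l.flatten.getD (i * k + x) 0 = l[i].getD x 0 := by
  induction l generalizing i with
  | nil => simp at hi
  | cons b l ih =>
    have hb : b.length = k := hl b (by simp)
    rw [List.flatten_cons]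
    cases i with
    | zero => rw [zero_mul, zero_add, List.getD_append _ _ _ _ (by omega)]; rfl
    | succ i =>
      rw [List.getD_append_right _ _ _ _ (by rw [hb, Nat.succ_mul]; omega), hb,
        show (i + 1) * k + x - k = i * k + x by rw [Nat.succ_mul]; omega,
        ih (fun b hb => hl b (List.mem_cons_of_mem _ hb)) (by simpa using hi)]
      rfl

theorem ofFn_getD {k : ℕ} (f : Fin k → ℕ) {x : ℕ} (hx : x < k) :
    (List.ofFn f).getD x 0 = f ⟨x, hx⟩ := by
  rw [List.getD_eq_getElem _ _ (by simpa using hx), List.getElem_ofFn]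

namespace ShiftBribery

variable (I : ShiftBribery)

theorem length_encodeVoter (i : Fin I.n) : (I.encodeVoter i).length = 2 * I.m + 2 := by
  simp only [encodeVoter, List.length_append, List.length_ofFn, List.length_singleton]
  omega

theorem length_encode : I.encode.length = 3 + I.n * (2 * I.m + 2) := by
  simp [encode, List.length_flatten, List.map_ofFn, Function.comp_def, length_encodeVoter]
  ring

theorem encode_getD_block (i : Fin I.n) {x : ℕ} (hx : x < 2 * I.m + 2) :
    I.encode.getD (3 + i * (2 * I.m + 2) + x) 0 = (I.encodeVoter i).getD x 0 := by
  rw [encode, List.getD_append_right _ _ _ _ (by simp; omega),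
    show 3 + (i : ℕ) * (2 * I.m + 2) + x - [I.m, I.n, (I.p : ℕ)].length =
      i * (2 * I.m + 2) + x by simp only [List.length_cons, List.length_nil]; omega,
    flatten_getD (k := 2 * I.m + 2) _ (by simp) hx]
  · simp
  · intro b hb
    obtain ⟨i, rfl⟩ := (List.mem_ofFn' _ _).1 hb
    exact I.length_encodeVoter i

/-- The data read off from the encoding of an instance. -/
def data : Data := dataOf I.encode

theorem data_m : I.data.m = I.m := rfl

theorem data_n : I.data.n = I.n := rfl

theorem data_p : I.data.p = I.p := rfl

theorem data_base (i : ℕ) : I.data.base i = 3 + i * (2 * I.m + 2) := rfl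

theorem data_len : I.data.len = 3 + I.n * (2 * I.m + 2) := I.length_encode

theorem n_lt_len : I.n < I.data.len := by
  rw [data_len]
  nlinarith [Nat.zero_le (I.n * I.m)]

/-- This makes the loops, which run as often as the input has words, long enough for all candidates,
shifts and rounds. Without voters the input has only three words and the bound can fail. -/
theorem m_add_n_lt_len (hn : I.n ≠ 0) : I.m + I.n < I.data.len := by
  rw [data_len]
  obtain ⟨k, hk⟩ := Nat.exists_eq_succ_of_ne_zero hn
  rw [hk]
  nlinarith [Nat.zero_le (k * I.m)]

theorem data_half : I.data.half = I.n / 2 := by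
  have := I.n_lt_len
  refine lastIndex_eq (P := fun i => i + i ≤ I.n) (k := I.data.len) ?_ (by omega) ?_
  · show I.n / 2 + I.n / 2 ≤ I.n
    omega
  · intro y hy
    have : y + y ≤ I.n := hy
    omega

theorem data_ord (i : Fin I.n) (x : Fin I.m) :
    I.data.ord i x = ((I.votes i).pos.symm x : ℕ) := by
  have hx : (x : ℕ) < 2 * I.m + 2 := by omega
  refine (I.encode_getD_block i hx).trans ?_
  rw [encodeVoter, List.append_assoc, List.getD_append _ _ _ _ (by simp), ofFn_getD _ x.2]

theorem data_app (i : Fin I.n) : I.data.app i = ((I.votes i).approvals : ℕ) := by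
  have h : I.data.app i = I.encode.getD (3 + i * (2 * I.m + 2) + I.m) 0 := rfl
  rw [h, I.encode_getD_block i (by omega), encodeVoter, List.append_assoc,
    List.getD_append_right _ _ _ _ (by simp)]
  simp

theorem data_pp (i : Fin I.n) : I.data.pp i = ((I.votes i).pos I.p : ℕ) := by
  have hlen := I.m_add_n_lt_len (Nat.ne_of_gt i.pos)
  refine lastIndex_eq (P := fun x => x < I.m ∧ I.data.ord i x = I.p) (k := I.data.len)
    ⟨Fin.is_lt _, ?_⟩ (by omega) ?_
  · rw [data_ord, Equiv.symm_apply_apply]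
  · rintro y ⟨hy, h⟩
    have := (I.data_ord i ⟨y, hy⟩).symm.trans h
    rw [← (Equiv.symm_apply_eq _).1 (Fin.ext this)]

theorem encode_getD_cost (i : Fin I.n) {x : ℕ} (hx : x < I.m + 1) :
    I.encode.getD (I.data.base i + (I.m + 1 + x)) 0 = encodeCost (I.cost i ⟨x, hx⟩) := by
  rw [data_base, encode_getD_block I i (by omega), encodeVoter,
    List.getD_append_right _ _ _ _ (by simp)]
  simp only [List.length_append, List.length_ofFn, List.length_singleton]
  rw [Nat.add_sub_cancel_left, ofFn_getD _ hx]

theorem data_point (j : ℕ) (i : Fin I.n) (t : ℕ) : I.data.point j i t =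
    if (((I.votes i).shift I.p t).pos I.p : ℕ) < min j (I.votes i).approvals then 1 else 0 := by
  rw [Data.point, data_pp, data_app, Voter.shift_pos_self]
  split_ifs <;> omega

/-- Only the candidate in the last position that counts can be pushed out by `p`, and only if `p`
starts below that position. -/
theorem data_group (j : ℕ) (i : Fin I.n) (c : Fin I.m) (hc : c ≠ I.p) :
    I.data.group j i = c ↔ ((I.votes i).pos c : ℕ) + 1 = min j (I.votes i).approvals ∧
      ((I.votes i).pos c : ℕ) < (I.votes i).pos I.p := by
  have hpc : (I.p : ℕ) ≠ c := fun h => hc (Fin.ext h.symm)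
  have hle : ((I.votes i).approvals : ℕ) ≤ I.m := Nat.lt_succ_iff.1 (Fin.is_lt _)
  rw [Data.group, data_pp, data_app]
  split_ifs with h
  · have hlt : min j ((I.votes i).approvals : ℕ) - 1 < I.m := by omega
    rw [I.data_ord i ⟨_, hlt⟩]
    constructor
    · intro h'
      have := congrArg (fun x : Fin I.m => (x : ℕ))
        ((Equiv.symm_apply_eq _).1 (Fin.ext h' : _ = c))
      simp only at this
      omega
    · rintro ⟨h₁, h₂⟩
      have : (⟨_, hlt⟩ : Fin I.m) = (I.votes i).pos c := Fin.ext (by simp only; omega)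
      rw [this, Equiv.symm_apply_apply]
  · rw [data_p]
    constructor
    · exact fun h => absurd h hpc
    · rintro ⟨h₁, h₂⟩
      omega

theorem data_group_lt (j : ℕ) (i : Fin I.n) : I.data.group j i < I.m := by
  have hle : ((I.votes i).approvals : ℕ) ≤ I.m := Nat.lt_succ_iff.1 (Fin.is_lt _)
  rw [Data.group, data_app]
  split_ifs with h
  · rw [I.data_ord i ⟨min j (I.votes i).approvals - 1, by omega⟩]
    exact Fin.is_lt _
  · exact I.p.2

theorem data_score (j : ℕ) (c : Fin I.m) : I.data.score j c = truncScore I.votes j c := by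
  rw [truncScore_eq_sum, Data.score, ← Finset.sum_filter]
  have : ({i ∈ Finset.range I.data.len | i < I.data.n} : Finset ℕ) = Finset.range I.n := by
    ext i
    have := I.n_lt_len
    rw [Finset.mem_filter, Finset.mem_range, Finset.mem_range]
    exact ⟨fun h => h.2, fun h => ⟨h.trans this, h⟩⟩
  rw [this, Finset.sum_range]
  refine Finset.sum_congr rfl fun i _ => ?_
  have hlen := I.m_add_n_lt_len (Nat.ne_of_gt i.pos)
  have hle : ((I.votes i).approvals : ℕ) ≤ I.m := Nat.lt_succ_iff.1 (Fin.is_lt _)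
  rw [Finset.sum_eq_single ((I.votes i).pos c : ℕ)]
  · rw [data_app, data_ord, Equiv.symm_apply_apply]
    simp
  · intro x _ hx
    rw [if_neg]
    rintro ⟨h₁, h₂⟩
    rw [data_app] at h₁
    rw [I.data_ord i ⟨x, by omega⟩] at h₂
    exact hx (congrArg (fun x : Fin I.m => (x : ℕ))
      ((Equiv.symm_apply_eq _).1 (Fin.ext h₂ : _ = c)))
  · intro h
    simp only [Finset.mem_range] at h
    omega

/-! ### The effect of a shift action on the scores. -/

/-- The shift action given by a function on the natural numbers. -/
def act (t : ℕ → ℕ) : I.Action := fun i => ⟨min (t i) I.m, by omega⟩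

variable {I}

theorem act_apply {t : ℕ → ℕ} (ht : ∀ i, t i ≤ I.m) (i : Fin I.n) : (I.act t i : ℕ) = t i :=
  min_eq_left (ht i)

theorem truncScore_shifted_self (j : ℕ) {t : ℕ → ℕ} (ht : ∀ i, t i ≤ I.m) :
    truncScore (I.shifted (I.act t)) j I.p =
      ∑ i ∈ Finset.range I.n, I.data.point j i (t i) := by
  rw [truncScore_eq_sum, Finset.sum_range]
  refine Finset.sum_congr rfl fun i _ => ?_
  rw [data_point, shifted, act_apply ht]
  rfl

/-- The identity holds voter by voter: a candidate passed by `p` moves down one place, so her point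
is lost exactly when she was in the last counted position and `p` enters the counted ones. -/
theorem truncScore_shifted_add (j : ℕ) {t : ℕ → ℕ} (ht : ∀ i, t i ≤ I.m) {c : Fin I.m}
    (hc : c ≠ I.p) : truncScore (I.shifted (I.act t)) j c +
      ∑ i ∈ Finset.range I.n with I.data.group j i = c, I.data.point j i (t i) =
        truncScore I.votes j c := by
  rw [truncScore_eq_sum, truncScore_eq_sum, Finset.sum_filter, Finset.sum_range,
    ← Finset.sum_add_distrib]
  refine Finset.sum_congr rfl fun i _ => ?_
  have hne : ((I.votes i).pos c : ℕ) ≠ (I.votes i).pos I.p :=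
    fun h => hc ((I.votes i).pos.injective (Fin.ext h))
  simp only [data_group I j i c hc, data_point, shifted, act_apply ht, Voter.shift_pos_self,
    Voter.shift_pos_of_ne _ hc, show ∀ t, ((I.votes i).shift I.p t).approvals =
      (I.votes i).approvals from fun _ => rfl]
  split_ifs <;> omega

theorem wins_iff (j : ℕ) {t : ℕ → ℕ} (ht : ∀ i, t i ≤ I.m) : I.data.Wins j t ↔
    I.data.target j ≤ truncScore (I.shifted (I.act t)) (j + 1) I.p ∧
      ∀ c ≠ I.p, truncScore (I.shifted (I.act t)) j c ≤ I.data.cap j := by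
  have hneed : ∀ c : Fin I.m, c ≠ I.p → (I.data.need j (I.data.cap j) c ≤
      ∑ i ∈ Finset.range I.n with I.data.group j i = c, I.data.point j i (t i) ↔
        truncScore (I.shifted (I.act t)) j c ≤ I.data.cap j) := by
    intro c hc
    have h := truncScore_shifted_add j ht hc
    rw [Data.need, data_p, if_neg (fun h => hc (Fin.ext h)), data_score]
    omega
  rw [truncScore_shifted_self _ ht]
  constructor
  · rintro ⟨h₁, h₂⟩
    exact ⟨h₁, fun c hc => (hneed c hc).1 (h₂ c c.2)⟩
  · rintro ⟨h₁, h₂⟩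
    refine ⟨h₁, fun c hcm => ?_⟩
    by_cases hc : c = I.p
    · rw [Data.need, if_pos (by rw [hc]; rfl)]
      exact Nat.zero_le _
    · exact (hneed ⟨c, hcm⟩ (fun h => hc (congrArg Fin.val h))).2
        (h₂ _ fun h => hc (congrArg Fin.val h))

theorem succeeds_iff {t : ℕ → ℕ} (ht : ∀ i, t i ≤ I.m) :
    I.Succeeds simplifiedFallback (I.act t) ↔ ∃ j ≤ I.m + I.n / 2, I.data.Wins j t := by
  rw [Succeeds, mem_simplifiedFallback_iff I.data_m I.data_half]
  simp only [wins_iff _ ht]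

/-- With `p` on top everywhere, her score in round `1` already bounds every score. If it is at most
`n / 2` it serves as target and cap; otherwise `j = 0` is a witness, since all scores in round `0`
vanish. -/
theorem succeeds_top : I.Succeeds simplifiedFallback (I.act fun _ => I.m) := by
  have hpos : ∀ i, ((I.shifted (I.act fun _ => I.m) i).pos I.p : ℕ) = 0 := by
    intro i
    rw [shifted, Voter.shift_pos_self, act_apply fun _ => le_rfl]
    omega
  have hmax : ∀ j k c, truncScore (I.shifted (I.act fun _ => I.m)) j c ≤
      truncScore (I.shifted (I.act fun _ => I.m)) (k + 1) I.p := by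
    intro j k c
    rw [truncScore_eq_sum, truncScore_eq_sum]
    refine Finset.sum_le_sum fun i _ => ?_
    rw [hpos]
    split_ifs <;> omega
  rw [Succeeds]
  generalize I.shifted (I.act fun _ => I.m) = E at hmax
  rw [mem_simplifiedFallback_iff I.data_m I.data_half]
  have hm : 0 < I.m := I.p.pos
  by_cases h : truncScore E 1 I.p ≤ I.n / 2
  · refine ⟨I.m + truncScore E 1 I.p, by omega, ?_, fun c _ => ?_⟩
    · rw [Data.target, data_m, data_half, if_neg (by omega), if_pos (by omega)]
      exact (by omega : _ ≤ truncScore E 1 I.p).trans (hmax _ _ _)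
    · rw [Data.cap, data_m, data_half, if_neg (by omega), if_pos (by omega)]
      exact (hmax _ 0 _).trans (by rw [zero_add]; omega)
  · refine ⟨0, by omega, ?_, fun c _ => by simp [truncScore_zero]⟩
    rw [Data.target, data_m, data_half, if_pos hm, zero_add]
    omega

open RAM RAM.Prog

/-! ## Correctness of the program -/

theorem top_le_inf : I.data.len * top I.encode < I.data.inf := by
  have : I.data.inf = 1 + I.data.len * top I.encode := rfl
  omega

theorem one_le_len : 1 ≤ I.data.len := by
  rw [data_len]
  omega

theorem price_encodeCost (x : ℕ∞) :
    price I.encode (encodeCost x) = if x = ⊤ then top I.encode else x.toNat := by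
  unfold price encodeCost
  split_ifs <;> simp_all

theorem price_le_top {x : ℕ} (hx : x ∈ I.encode) : price I.encode x ≤ top I.encode := by
  have h₁ : x ≤ I.encode.sum := List.single_le_sum (fun _ _ => Nat.zero_le _) _ hx
  have h₂ : 1 * I.encode.sum ≤ I.encode.length * I.encode.sum :=
    Nat.mul_le_mul_right _ one_le_len
  unfold price
  split_ifs
  · exact le_rfl
  · unfold top
    omega

theorem need_lt_len (j : ℕ) (c : ℕ) (hc : c < I.m) :
    I.data.need j (I.data.cap j) c < I.data.len := by
  refine lt_of_le_of_lt ?_ I.n_lt_len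
  unfold Data.need
  split_ifs
  · exact Nat.zero_le _
  · refine (Nat.sub_le _ _).trans ?_
    rw [I.data_score j ⟨c, hc⟩]
    exact (Finset.card_le_univ _).trans (by simp)

theorem target_lt_len (j : ℕ) : I.data.target j < I.data.len := by
  have h : I.n / 2 + 1 < I.data.len := by
    rw [data_len]
    have : I.n * 1 ≤ I.n * (2 * I.m + 2) := Nat.mul_le_mul_left _ (by omega)
    omega
  unfold Data.target
  rw [data_half]
  split_ifs <;> omega

theorem address_lt {i x : ℕ} (hi : i < I.n) (hx : x ≤ I.m) :
    I.data.base i + (I.data.m + 1 + x) < I.data.len := by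
  rw [data_base, data_len, data_m]
  have : (i + 1) * (2 * I.m + 2) ≤ I.n * (2 * I.m + 2) := Nat.mul_le_mul_right _ hi
  rw [Nat.succ_mul] at this
  omega

theorem address_inj {i i' x x' : ℕ} (hx : x ≤ I.m) (hx' : x' ≤ I.m)
    (h : I.data.base i + (I.data.m + 1 + x) = I.data.base i' + (I.data.m + 1 + x')) :
    i = i' ∧ x = x' := by
  rw [data_base, data_base, data_m] at h
  have := (row_add_inj (L := 2 * I.m + 2) (g := i) (g' := i') (d := x) (d' := x')
    (by omega) (by omega)).1 (by omega)
  exact this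

theorem cost_eq {C : ℕ → ℕ}
    (hC : ∀ a < I.data.len, C a = price I.encode (I.encode.getD a 0)) (i : Fin I.n) (x : Fin (I.m + 1)) : I.data.cost C i x =
    if I.cost i x = ⊤ then top I.encode else (I.cost i x).toNat := by
  rw [Data.cost, hC _ (address_lt i.2 (Nat.lt_succ_iff.1 x.2)), ← price_encodeCost]
  exact congrArg _ (I.encode_getD_cost i x.2)

/-- Every input word receives a price, also those that are not costs. The search visits all
addresses, so the bound is needed for all of them. -/
theorem cost_array_le {C : ℕ → ℕ}
    (hC : ∀ a < I.data.len, C a = price I.encode (I.encode.getD a 0)) (a : ℕ) (ha : a < I.data.len) : C a ≤ top I.encode := by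
  rw [hC a ha, List.getD_eq_getElem _ _ ha]
  exact price_le_top (List.getElem_mem _)

/-- A finite total is at most `I.n * I.encode.sum`, hence below `top I.encode`, while one infinite
cost already contributes `top I.encode`. So if `s` has finite cost, so does `t`, and the numbers
compare as the costs do. -/
theorem totalCost_le {C : ℕ → ℕ}
    (hC : ∀ a < I.data.len, C a = price I.encode (I.encode.getD a 0)) {s t : I.Action}
    (h : ∑ i : Fin I.n, I.data.cost C i (t i) ≤ ∑ i : Fin I.n, I.data.cost C i (s i)) :
    I.totalCost t ≤ I.totalCost s := by
  have coe_sum : ∀ u : I.Action, (∀ i, I.cost i (u i) ≠ ⊤) →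
      I.totalCost u = ((∑ i : Fin I.n, I.data.cost C i (u i) : ℕ) : ℕ∞) := by
    intro u hu
    rw [totalCost, Nat.cast_sum]
    refine Finset.sum_congr rfl fun i _ => ?_
    rw [cost_eq hC, if_neg (hu i), ENat.natCast_toNat (hu i)]
  by_cases hs : ∀ i, I.cost i (s i) ≠ ⊤
  · have hlt : ∑ i : Fin I.n, I.data.cost C i (s i) < top I.encode := by
      have : ∀ i ∈ (Finset.univ : Finset (Fin I.n)), I.data.cost C i (s i) ≤ I.encode.sum := by
        intro i _
        rw [cost_eq hC, if_neg (hs i)]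
        have hmem : encodeCost (I.cost i (s i)) ∈ I.encode := by
          have ha : I.data.base i + (I.m + 1 + s i) < I.encode.length :=
            address_lt i.2 (Nat.lt_succ_iff.1 (s i).2)
          rw [← I.encode_getD_cost i (s i).2, List.getD_eq_getElem _ _ ha]
          exact List.getElem_mem _
        have := List.single_le_sum (fun _ _ => Nat.zero_le _) _ hmem
        rw [encodeCost, if_neg (hs i)] at this
        omega
      have h₁ := Finset.sum_le_card_nsmul _ _ _ this
      rw [Finset.card_univ, Fintype.card_fin, smul_eq_mul] at h₁
      have h₂ : I.n * I.encode.sum ≤ I.encode.length * I.encode.sum :=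
        Nat.mul_le_mul_right _ I.n_lt_len.le
      unfold top
      omega
    have ht : ∀ i, I.cost i (t i) ≠ ⊤ := by
      intro i hi
      have := Finset.single_le_sum (f := fun i : Fin I.n => I.data.cost C i (t i))
        (fun _ _ => Nat.zero_le _) (Finset.mem_univ i)
      rw [cost_eq hC, if_pos hi] at this
      omega
    rw [coe_sum s hs, coe_sum t ht]
    exact_mod_cast h
  · push Not at hs
    obtain ⟨i, hi⟩ := hs
    rw [show I.totalCost s = ⊤ from WithTop.sum_eq_top.2 ⟨i, Finset.mem_univ i, hi⟩]
    exact le_top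

theorem exists_optimal {C : ℕ → ℕ}
    (hC : ∀ a < I.data.len, C a = price I.encode (I.encode.getD a 0)) (hn : I.n ≠ 0) : ∃ t : I.Action, I.IsOptimal simplifiedFallback t ∧
    ∀ i : Fin I.n, ∀ x ≤ I.m,
      I.data.cost (I.data.search C (I.data.value C) I.data.len) i x < I.data.inf ↔ x = t i := by
  have hm : I.data.m < I.data.len := (Nat.le_add_right _ _).trans_lt (I.m_add_n_lt_len hn)
  have hgroup : ∀ j, ∀ i < I.data.n, I.data.group j i < I.data.m :=
    fun j i hi => I.data_group_lt j ⟨i, hi⟩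
  have hle : ∀ C, ∀ t ∈ {t : ℕ → ℕ | (∀ i, t i ≤ I.m) ∧ I.Succeeds simplifiedFallback (I.act t)},
      I.data.value C ≤ ∑ i ∈ Finset.range I.data.n, I.data.cost C i (t i) := by
    rintro C t ⟨ht, hs⟩
    obtain ⟨j, hj, hw⟩ := (succeeds_iff ht).1 hs
    have := I.m_add_n_lt_len hn
    exact Data.value_le hm I.n_lt_len hgroup (by omega) ht hw
  -- Moving `p` to the top everywhere costs at most `top I.encode` per voter, and there are fewer
  -- voters than input words.
  have htop : I.data.value C < I.data.inf := by
    refine (hle C (fun _ => I.m) ⟨fun _ => le_rfl, succeeds_top⟩).trans_lt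
      (lt_of_le_of_lt ?_ top_le_inf)
    refine (Finset.sum_le_card_nsmul _ _ (top I.encode) fun i hi => cost_array_le hC _
      (address_lt (Finset.mem_range.1 hi) le_rfl)).trans ?_
    rw [Finset.card_range, smul_eq_mul]
    exact Nat.mul_le_mul_right _ I.n_lt_len.le
  obtain ⟨t, ⟨ht, hs⟩, hmin, hsearch⟩ := Data.search_spec hle
    (fun C h => by
      obtain ⟨j, t, ht, hw, heq⟩ := Data.exists_of_value_lt hm I.n_lt_len hgroup h
      obtain ⟨h₁, h₂⟩ := (wins_iff j ht).1 hw
      exact ⟨t, ⟨ht, mem_simplifiedFallback_of_target_le I.data_m I.data_half h₁ h₂⟩, heq⟩)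
    (fun t h => h.1)
    (fun a ha => ((cost_array_le hC a ha).trans (Nat.le_mul_of_pos_left _ one_le_len)).trans
      top_le_inf.le) htop
    (fun i hi x hx => address_lt hi hx) (fun i i' x x' hx hx' h => address_inj hx hx' h)
  refine ⟨I.act t, ⟨hs, fun s hs' => totalCost_le hC ?_⟩, fun i x hx => ?_⟩
  · have h := hmin (fun i => if h : i < I.n then s ⟨i, h⟩ else 0) ⟨fun i => ?_, ?_⟩
    · simp only [data_n, Finset.sum_range, Fin.is_lt, dite_true] at h
      simpa only [act_apply ht] using h
    · simp only
      split_ifs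
      · exact Nat.lt_succ_iff.1 (Fin.is_lt _)
      · exact Nat.zero_le _
    · convert hs'
      funext i
      refine Fin.ext ?_
      simp [act, Nat.lt_succ_iff.1 (s i).2]
  · rw [act_apply ht]
    exact hsearch i i.2 x hx

theorem flatMap_range_eq {n l : ℕ} (hnl : n ≤ l) (t : Fin n → ℕ) (f : ℕ → List ℕ)
    (hf : ∀ i : Fin n, f i = [t i]) :
    (List.range l).flatMap (fun i => if i < n then f i else []) = List.ofFn t := by
  have h₁ : ∀ l, n ≤ l → (List.range l).flatMap (fun i => if i < n then f i else []) =
      (List.range n).flatMap fun i => if i < n then f i else [] := by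
    intro l hl
    induction l, hl using Nat.le_induction with
    | base => rfl
    | succ l hl ih => simp [List.range_succ, ih, not_lt.2 hl]
  rw [h₁ l hnl]
  clear h₁ hnl
  have h₂ : ∀ i ∈ List.range n, (if i < n then f i else []) =
      [if h : i < n then t ⟨i, h⟩ else 0] := by
    intro i hi
    have hi := List.mem_range.1 hi
    rw [if_pos hi, dif_pos hi]
    exact hf ⟨i, hi⟩
  rw [List.flatMap_congr h₂, ← List.map_eq_flatMap]
  exact List.ext_getElem (by simp) fun i h _ => by
    have : i < n := by simpa using h
    simp [this]

theorem mainProg_correct (I : ShiftBribery) : ∃ t : I.Action,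
    (mainProg.run (init I.encode)).out = I.encodeAction t ∧ I.IsOptimal simplifiedFallback t := by
  obtain ⟨C, hC, hout⟩ := mainProg_spec I.encode (fun j c hc => I.need_lt_len j c hc)
    (fun j => I.target_lt_len j)
  rw [hout]
  by_cases hn : I.n = 0
  -- Without voters the loops may be too short to see all candidates, but nothing is written and
  -- there is only one action.
  · have : IsEmpty (Fin I.n) := by rw [hn]; infer_instance
    refine ⟨I.act fun _ => I.m, ?_, succeeds_top, fun s _ => ?_⟩
    · have h : (dataOf I.encode).n = 0 := hn
      simp [h, encodeAction, hn]
    · rw [Subsingleton.elim s]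
  · obtain ⟨t, ht, hsearch⟩ := exists_optimal hC hn
    refine ⟨t, ?_, ht⟩
    refine flatMap_range_eq (n := I.n) I.n_lt_len.le (fun i => (t i : ℕ)) _ fun i => ?_
    have hlt : (t i : ℕ) < I.encode.length :=
      (Nat.lt_succ_iff.1 (t i).2).trans_lt ((Nat.le_add_right _ _).trans_lt (I.m_add_n_lt_len hn))
    -- Exactly one shift per voter has kept an affordable cost, so the filter leaves the single
    -- number `t i`.
    have hfilter : ∀ x ∈ List.range I.encode.length,
        decide (x ≤ I.data.m ∧ I.data.cost (I.data.search C (I.data.value C) I.data.len) i x <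
          I.data.inf) = decide (x = (t i : ℕ)) := by
      intro x _
      rw [decide_eq_decide]
      constructor
      · rintro ⟨h₁, h₂⟩
        exact (hsearch i x h₁).1 h₂
      · rintro rfl
        exact ⟨Nat.lt_succ_iff.1 (t i).2, (hsearch i _ (Nat.lt_succ_iff.1 (t i).2)).2 rfl⟩
    refine (List.filter_congr hfilter).trans ?_
    rw [List.filter_eq, List.count_eq_one_of_mem List.nodup_range (List.mem_range.2 hlt)]
    rfl

end ShiftBribery
end Voting

theorem theorem2 :
    RAM.SolvableInPolyTime Voting.ShiftBribery.encode Voting.ShiftBribery.encodeAction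
      (Voting.ShiftBribery.IsOptimal Voting.simplifiedFallback) :=
  RAM.solvableInPolyTime_of_prog Voting.Bribery.mainProg rfl
    Voting.ShiftBribery.mainProg_correct
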